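/- Let $n\ge 2$ and let $S(n)$ be the space of real symmetric $n\times n$ matrices. Let $F\colon S(n)\to\mathbb R$ be sublinear, i.e. $F(X+Y)\le F(X)+F(Y)$ and $F(tX)=tF(X)$ for all $X,Y\in S(n)$ and $t\ge 0$, and uniformly elliptic, i.e. there are constants $0<\lambda\le\Lambda$ with $\lambda\,\mathrm{tr}A\le F(X+A)-F(X)\le\Lambda\,\mathrm{tr}A$ for all $X,A\in S(n)$ with $A\ge 0$. A (viscosity) supersolution of $F(\mathcal Hu)=0$ in $\mathbb R^n$, where $\mathcal H$ denotes the Hessian matrix, is a lower semicontinuous function $u\colon\mathbb R^n\to(-\infty,\infty]$ that is finite on a dense set and such that $F(\mathcal H\phi(x_0))\le 0$ whenever $\phi\in C^2$, $\phi(x_0)=u(x_0)$ and $\phi\le u$ near $x_0$. Let $u$ be a supersolution of $F(\mathcal Hu)=0$ in $\mathbb R^n$, let $\mu\ge 0$ be a Radon measure on $\mathbb R^n$, and define the convolution $$w(x):=(u*\mu)(x)=\int_{\mathbb R^n}u(x-y)\,\mu(dy).$$ Write $u^-:=\max\{-u,0\}$. Assume that one of the following conditions holds. 1. $w\not\equiv\infty$,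 and for every $R>0$ there is a $\mu$-integrable function $C_R\colon\mathbb R^n\to\mathbb R$ such that $u^-(x-y)\le C_R(y)$ for all $x\in B(0,R)$ and all $y\in\mathbb R^n$. 2. $w\not\equiv\infty$ and $u\ge 0$. 3. $u(x)=c|x|^{\frac{p-n}{p-1}}$ for some $c\ge 0$ and $2\le p<n$ (with $u(0)=\infty$ if $c>0$, and $u\equiv 0$ if $c=0$), and $\int_{|y|\ge 1}|y|^{\frac{p-n}{p-1}}\,\mu(dy)<\infty$. 4. $w\not\equiv\infty$ and $\mu$ has compact support. Then $w$ is a supersolution of $F(\mathcal Hw)=0$ in $\mathbb R^n$. -/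

import Mathlib

open MeasureTheory Topology
open scoped ENNReal

namespace SublinearElliptic

/-- The Euclidean space `ℝⁿ`. -/
abbrev E (n : ℕ) : Type := EuclideanSpace ℝ (Fin n)

/-- The real vector space `S(n)` of symmetric real `n × n` matrices (over `ℝ` the star operation
on matrices is transposition). -/
abbrev SymMat (n : ℕ) : Type := selfAdjoint (Matrix (Fin n) (Fin n) ℝ)

/-- `F : S(n) → ℝ` is sublinear: subadditive and positively homogeneous. -/
structure IsSublinear {n : ℕ} (F : SymMat n → ℝ) : Prop where
  subadd : ∀ X Y : SymMat n, F (X + Y) ≤ F X + F Y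
  posHom : ∀ (t : ℝ) (X : SymMat n), 0 ≤ t → F (t • X) = t * F X

/-- `F : S(n) → ℝ` is uniformly elliptic: there are constants `0 < lam ≤ Lam` such that
`lam · tr A ≤ F (X + A) - F X ≤ Lam · tr A` for all symmetric `X` and all symmetric `A ≥ 0`. -/
def IsUniformlyElliptic {n : ℕ} (F : SymMat n → ℝ) : Prop :=
  ∃ lam Lam : ℝ, 0 < lam ∧ lam ≤ Lam ∧
    ∀ X A : SymMat n, (A : Matrix (Fin n) (Fin n) ℝ).PosSemidef →
      lam * (A : Matrix (Fin n) (Fin n) ℝ).trace ≤ F (X + A) - F X ∧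
        F (X + A) - F X ≤ Lam * (A : Matrix (Fin n) (Fin n) ℝ).trace

/-- The matrix of second partial derivatives `∂²φ / ∂xᵢ∂xⱼ` at `x`. -/
noncomputable def hessianMatrix {n : ℕ} (φ : E n → ℝ) (x : E n) : Matrix (Fin n) (Fin n) ℝ :=
  Matrix.of fun i j =>
    fderiv ℝ (fderiv ℝ φ) x (EuclideanSpace.single i 1) (EuclideanSpace.single j 1)

/-- The Hessian matrix of a `C²` function is symmetric. -/
theorem hessianMatrix_mem {n : ℕ} {φ : E n → ℝ} (hφ : ContDiff ℝ 2 φ) (x : E n) :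
    hessianMatrix φ x ∈ selfAdjoint (Matrix (Fin n) (Fin n) ℝ) := by
  rw [selfAdjoint.mem_iff]
  ext i j
  have h : IsSymmSndFDerivAt ℝ φ x := hφ.contDiffAt.isSymmSndFDerivAt (by simp)
  simpa [hessianMatrix, Matrix.star_apply] using
    h.eq (EuclideanSpace.single j 1) (EuclideanSpace.single i 1)

/-- The Hessian `ℋφ(x) ∈ S(n)` of a `C²` function. -/
noncomputable def hessian {n : ℕ} (φ : E n → ℝ) (hφ : ContDiff ℝ 2 φ) (x : E n) : SymMat n :=
  ⟨hessianMatrix φ x, hessianMatrix_mem hφ x⟩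

/-- `u : ℝⁿ → (-∞, ∞]` is a viscosity supersolution of `F(ℋu) = 0` in `ℝⁿ`. -/
structure IsViscositySupersolution {n : ℕ} (F : SymMat n → ℝ) (u : E n → EReal) : Prop where
  ne_bot : ∀ x, u x ≠ ⊥
  lsc : LowerSemicontinuous u
  dense_lt_top : Dense {x | u x < ⊤}
  test : ∀ (φ : E n → ℝ) (hφ : ContDiff ℝ 2 φ) (x₀ : E n),
    (φ x₀ : EReal) = u x₀ → (∀ᶠ x in 𝓝 x₀, (φ x : EReal) ≤ u x) → F (hessian φ hφ x₀) ≤ 0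

/-- The convolution `(u * μ)(x) = ∫ u(x - y) μ(dy)` of an extended real valued function with a
measure: the integral of the positive part minus the integral of the negative part. It is a
genuine integral with value in `(-∞, ∞]` whenever the integral of the negative part is finite;
otherwise its value is `⊥`. -/
noncomputable def convMeasure {n : ℕ} (u : E n → EReal) (μ : Measure (E n)) (x : E n) : EReal :=
  ((∫⁻ y, (u (x - y)).toENNReal ∂μ : ℝ≥0∞) : EReal) -
    ((∫⁻ y, (-u (x - y)).toENNReal ∂μ : ℝ≥0∞) : EReal)

end SublinearElliptic

/-! The viscosity inequality is traded for a mean value inequality, which is linear in `u` and so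
passes through the integral against `μ`.

By Hahn–Banach (`IsSublinear.exists_linear_le`) `F` is the pointwise maximum of its linear minorants
`L`, and each of these is elliptic. A supersolution for `F` is one for every such `L`; conversely,
to test `w` at a point it suffices to use one `L` that agrees with `F` at the Hessian of the test
function. This reduces the problem to a constant coefficient linear operator.

For fixed `L`, comparison with smooth subsolutions on the unit ball follows from the definition of
supersolution. The Dirichlet problem with polynomial data has a polynomial solution by a dimension
count (`exists_polyOp_eq_zero`). Evaluation of solutions at the center is then a positive functional
of their boundary values, and Riesz representation turns it into a probability measure `σ` on the
sphere (`exists_isHarmonicMeasure`). Comparison gives `∫ u(x + r y) σ(dy) ≤ u(x)` for supersolutions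
and the reverse inequality at the center for smooth subsolutions; since `L` has constant
coefficients, the same `σ` serves every ball.

Tonelli transfers the inequality to `w` (`IsHarmonicMeasure.lintegral_posConv_le`). If a test
function `φ` touched `w` from below at `x₀` with `L` of its Hessian positive, a small sphere would
give `φ(x₀) < ∫ φ ≤ ∫ w ≤ w(x₀) = φ(x₀)`, averages being taken with respect to `σ`. Lower
semicontinuity of `w` is Fatou's lemma. Finiteness on a dense set propagates from a single point by
the mean value inequality, because `σ` charges every cap of a fixed size
(`IsHarmonicMeasure.exists_cap_pos`).

All four conditions yield a locally uniform `μ`-integrable bound on the negative part,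
`HasDominatedNegPart`. Only the third must also produce a point where `w` is finite. -/

namespace SublinearElliptic

/-! ### Linear minorants of a sublinear elliptic function. -/

/-- A linear functional on `S(n)` is elliptic if it dominates a positive multiple of the trace on
positive semidefinite matrices. -/
def IsEllipticFunctional {n : ℕ} (L : SymMat n →ₗ[ℝ] ℝ) (lam : ℝ) : Prop :=
  0 < lam ∧ ∀ A : SymMat n, (A : Matrix (Fin n) (Fin n) ℝ).PosSemidef →
    lam * (A : Matrix (Fin n) (Fin n) ℝ).trace ≤ L A

theorem IsSublinear.map_zero {n : ℕ} {F : SymMat n → ℝ} (hF : IsSublinear F) : F 0 = 0 := by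
  simpa using hF.posHom 0 0 le_rfl

/-- A sublinear function has a linear minorant touching it at a given point. -/
theorem IsSublinear.exists_linear_le {n : ℕ} {F : SymMat n → ℝ} (hF : IsSublinear F)
    (X₀ : SymMat n) : ∃ L : SymMat n →ₗ[ℝ] ℝ, (∀ X, L X ≤ F X) ∧ L X₀ = F X₀ := by
  have hpos : ∀ c : ℝ, 0 < c → ∀ X, F (c • X) = c * F X := fun c hc X => hF.posHom c X hc.le
  by_cases h0 : X₀ = 0
  · obtain ⟨L, -, hL⟩ := exists_extension_of_le_sublinear (⊥ : SymMat n →ₗ.[ℝ] ℝ) F hpos hF.subadd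
      (fun ⟨x, hx⟩ => by
        have hx0 : x = 0 := (Submodule.mem_bot ℝ).1 hx
        subst hx0
        rw [hF.map_zero]
        exact le_of_eq (LinearPMap.map_zero _))
    exact ⟨L, hL, by rw [h0, hF.map_zero, _root_.map_zero]⟩
  · obtain ⟨L, hext, hL⟩ := exists_extension_of_le_sublinear
      (LinearPMap.mkSpanSingleton X₀ (F X₀) h0) F hpos hF.subadd
      (fun ⟨x, hx⟩ => by
        obtain ⟨t, rfl⟩ := Submodule.mem_span_singleton.1 hx
        have hv : LinearPMap.mkSpanSingleton X₀ (F X₀) h0 ⟨t • X₀, hx⟩ = t • F X₀ :=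
          LinearPMap.mkSpanSingleton'_apply _ _ _ _ _
        change LinearPMap.mkSpanSingleton X₀ (F X₀) h0 ⟨t • X₀, hx⟩ ≤ F (t • X₀)
        rw [hv]
        -- For `t < 0`, subadditivity gives `0 = F 0 ≤ F (t • X₀) + F (-t • X₀)`, and the last term
        -- is `-t * F X₀`.
        rcases le_or_gt 0 t with ht | ht
        · rw [hF.posHom t X₀ ht, smul_eq_mul]
        · have h1 := hF.posHom (-t) X₀ (by linarith)
          have h2 := hF.subadd (t • X₀) ((-t) • X₀)
          rw [← add_smul, add_neg_cancel, zero_smul, hF.map_zero, h1] at h2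
          rw [smul_eq_mul]; linarith)
    refine ⟨L, hL, ?_⟩
    have := hext ⟨X₀, Submodule.mem_span_singleton_self X₀⟩
    rw [this]
    exact LinearPMap.mkSpanSingleton_apply ℝ ℝ h0 (F X₀)

/-- Linear minorants of a uniformly elliptic sublinear function are elliptic. -/
theorem IsUniformlyElliptic.isEllipticFunctional {n : ℕ} {F : SymMat n → ℝ} (hF : IsSublinear F)
    (hell : IsUniformlyElliptic F) :
    ∃ lam : ℝ, ∀ L : SymMat n →ₗ[ℝ] ℝ, (∀ X, L X ≤ F X) → IsEllipticFunctional L lam := by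
  obtain ⟨lam, Lam, hlam, -, h⟩ := hell
  refine ⟨lam, fun L hL => ⟨hlam, fun A hA => ?_⟩⟩
  -- Ellipticity based at `-A` bounds `-F (-A)` from below, and `L (-A) ≤ F (-A)` gives `-F (-A) ≤ L
  -- A`.
  have h1 := (h (-A) A hA).1
  rw [neg_add_cancel, hF.map_zero] at h1
  have h2 := hL (-A)
  rw [map_neg] at h2
  linarith

/-! ### Calculus of Hessians and the second order condition at a maximum. -/

section Hessian

variable {n : ℕ} {φ ψ : E n → ℝ}

theorem contDiff_fderiv (hφ : ContDiff ℝ 2 φ) : ContDiff ℝ 1 (fderiv ℝ φ) :=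
  hφ.fderiv_right (by norm_num)

theorem hessian_add (hφ : ContDiff ℝ 2 φ) (hψ : ContDiff ℝ 2 ψ)
    (h : ContDiff ℝ 2 (fun x => φ x + ψ x)) (x : E n) :
    hessian (fun x => φ x + ψ x) h x = hessian φ hφ x + hessian ψ hψ x := by
  apply Subtype.ext
  have h1 : fderiv ℝ (fun x => φ x + ψ x) = fun x => fderiv ℝ φ x + fderiv ℝ ψ x := by
    funext y
    exact fderiv_fun_add (hφ.differentiable (by norm_num) y) (hψ.differentiable (by norm_num) y)
  ext i j
  simp only [hessian, hessianMatrix, h1, Matrix.of_apply, AddSubgroup.coe_add, Matrix.add_apply]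
  rw [fderiv_fun_add ((contDiff_fderiv hφ).differentiable (by norm_num) x)
    ((contDiff_fderiv hψ).differentiable (by norm_num) x)]
  rfl

theorem hessian_comp_affine (hφ : ContDiff ℝ 2 φ) (a : E n) (r : ℝ)
    (h : ContDiff ℝ 2 (fun x => φ (a + r • x))) (x : E n) :
    hessian (fun x => φ (a + r • x)) h x = r ^ 2 • hessian φ hφ (a + r • x) := by
  apply Subtype.ext
  have haff : ∀ y : E n, HasFDerivAt (fun y : E n => a + r • y)
      (r • ContinuousLinearMap.id ℝ (E n)) y := fun y =>
    ((hasFDerivAt_id y).const_smul r).const_add a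
  have h1 : fderiv ℝ (fun x => φ (a + r • x)) = fun x => r • fderiv ℝ φ (a + r • x) := by
    funext y
    have := ((hφ.differentiable (by norm_num) (a + r • y)).hasFDerivAt.comp y (haff y)).fderiv
    rw [Function.comp_def] at this
    rw [this]
    ext v
    simp
  ext i j
  simp only [hessian, hessianMatrix, h1, Matrix.of_apply, selfAdjoint.val_smul, Matrix.smul_apply]
  have h2 := (((contDiff_fderiv hφ).differentiable (by norm_num)
    (a + r • x)).hasFDerivAt.comp x (haff x)).const_smul r
  rw [Function.comp_def] at h2
  have h3 : fderiv ℝ (fun x => r • fderiv ℝ φ (a + r • x)) x = _ := h2.fderiv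
  rw [h3]
  simp
  ring

theorem fderiv_fderiv_apply_nonpos_of_isLocalMax (hφ : ContDiff ℝ 2 φ) {x : E n}
    (hx : IsLocalMax φ x) (v : E n) : fderiv ℝ (fderiv ℝ φ) x v v ≤ 0 := by
  by_contra! hpos
  have hline : ∀ t : ℝ, HasDerivAt (fun t : ℝ => x + t • v) v t := fun t => by
    simpa using ((hasDerivAt_id t).smul_const v).const_add x
  have h1 : ∀ t : ℝ, HasDerivAt (fun t : ℝ => φ (x + t • v)) (fderiv ℝ φ (x + t • v) v) t :=
    fun t => (hφ.differentiable (by norm_num) _).hasFDerivAt.comp_hasDerivAt t (hline t)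
  have h1' : deriv (fun t : ℝ => φ (x + t • v)) = fun t => fderiv ℝ φ (x + t • v) v :=
    funext fun t => (h1 t).deriv
  have h2 : HasDerivAt (fun t : ℝ => fderiv ℝ φ (x + t • v) v)
      (fderiv ℝ (fderiv ℝ φ) x v v) 0 := by
    have h3 : HasFDerivAt (fderiv ℝ φ) (fderiv ℝ (fderiv ℝ φ) x) (x + (0 : ℝ) • v) := by
      simpa using ((contDiff_fderiv hφ).differentiable (by norm_num) x).hasFDerivAt
    have h4 := h3.comp_hasDerivAt (0 : ℝ) (hline 0)
    simpa using h4.clm_apply (hasDerivAt_const (0 : ℝ) v)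
  have hfx : fderiv ℝ φ x = 0 := hx.fderiv_eq_zero
  -- A positive second derivative at a critical point makes it a local minimum as well, so `φ` is
  -- constant along the line near `x` and that second derivative vanishes.
  have hmin : IsLocalMin (fun t : ℝ => φ (x + t • v)) 0 := by
    apply isLocalMin_of_deriv_deriv_pos
    · rw [h1', h2.deriv]; exact hpos
    · rw [h1']; simp [hfx]
    · exact (h1 0).continuousAt
  have hmax : IsLocalMax (fun t : ℝ => φ (x + t • v)) 0 := by
    have hc : Filter.Tendsto (fun t : ℝ => x + t • v) (𝓝 0) (𝓝 x) := by
      simpa using (hline 0).continuousAt.tendsto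
    have := hc.eventually hx
    filter_upwards [this] with t ht
    simpa using ht
  have hconst : (fun t : ℝ => φ (x + t • v)) =ᶠ[𝓝 0] fun _ => φ x := by
    filter_upwards [hmin, hmax] with t h1 h2
    simpa using le_antisymm h2 h1
  have h5 : deriv (deriv (fun t : ℝ => φ (x + t • v))) 0 = 0 := by
    rw [hconst.deriv.deriv_eq]
    simp
  rw [h1', h2.deriv] at h5
  linarith

theorem posSemidef_neg_hessian_of_isLocalMax (hφ : ContDiff ℝ 2 φ) {x : E n}
    (hx : IsLocalMax φ x) :
    ((-hessian φ hφ x : SymMat n) : Matrix (Fin n) (Fin n) ℝ).PosSemidef := by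
  refine Matrix.PosSemidef.of_dotProduct_mulVec_nonneg (-hessian φ hφ x).2 fun v => ?_
  have h := fderiv_fderiv_apply_nonpos_of_isLocalMax hφ hx (WithLp.toLp 2 v)
  have hv : (WithLp.toLp 2 v : E n) = ∑ i, v i • EuclideanSpace.single i (1 : ℝ) := by
    ext j
    simp [Pi.single_apply]
  rw [hv] at h
  simp only [map_sum, map_smul, _root_.sum_apply, _root_.smul_apply,
    smul_eq_mul, Finset.mul_sum] at h
  have h2 : star v ⬝ᵥ (((-hessian φ hφ x : SymMat n) : Matrix (Fin n) (Fin n) ℝ).mulVec v) =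
      -∑ i, ∑ j, v i * (v j * fderiv ℝ (fderiv ℝ φ) x (EuclideanSpace.single i 1)
        (EuclideanSpace.single j 1)) := by
    simp only [dotProduct, Matrix.mulVec, hessian, hessianMatrix, AddSubgroup.coe_neg,
      Matrix.neg_apply, Matrix.of_apply, Pi.star_apply, star_trivial, Finset.mul_sum,
      ← Finset.sum_neg_distrib]
    refine Finset.sum_congr rfl fun i _ => Finset.sum_congr rfl fun j _ => ?_
    ring
  rw [h2]
  rw [Finset.sum_comm] at h
  have h3 : ∑ i, ∑ j, v j * (v i * fderiv ℝ (fderiv ℝ φ) x (EuclideanSpace.single i 1)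
      (EuclideanSpace.single j 1)) = ∑ i, ∑ j, v i * (v j * fderiv ℝ (fderiv ℝ φ) x
        (EuclideanSpace.single i 1) (EuclideanSpace.single j 1)) :=
    Finset.sum_congr rfl fun i _ => Finset.sum_congr rfl fun j _ => by ring
  linarith

theorem IsEllipticFunctional.hessian_nonpos_of_isLocalMax {L : SymMat n →ₗ[ℝ] ℝ} {lam : ℝ}
    (hL : IsEllipticFunctional L lam) (hφ : ContDiff ℝ 2 φ) {x : E n} (hx : IsLocalMax φ x) :
    L (hessian φ hφ x) ≤ 0 := by
  have h := posSemidef_neg_hessian_of_isLocalMax hφ hx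
  have h1 := hL.2 _ h
  rw [map_neg] at h1
  have h2 : 0 ≤ lam * ((-hessian φ hφ x : SymMat n) : Matrix (Fin n) (Fin n) ℝ).trace :=
    mul_nonneg hL.1.le h.trace_nonneg
  linarith

end Hessian

/-! ### Polynomials and constant coefficient second order operators. -/

section Polynomial

variable {n : ℕ}

/-- The function on `ℝⁿ` defined by a polynomial. -/
noncomputable def polyFun (P : MvPolynomial (Fin n) ℝ) (x : E n) : ℝ := MvPolynomial.eval x P

theorem hasFDerivAt_polyFun (P : MvPolynomial (Fin n) ℝ) (x : E n) :
    HasFDerivAt (polyFun P)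
      (∑ i, polyFun (MvPolynomial.pderiv i P) x • EuclideanSpace.proj (𝕜 := ℝ) i) x := by
  induction P using MvPolynomial.induction_on with
  | C a =>
    have : polyFun (MvPolynomial.C a : MvPolynomial (Fin n) ℝ) = fun _ => a := by
      funext y; simp [polyFun]
    rw [this]
    exact (hasFDerivAt_const a x).congr_fderiv (by simp [polyFun])
  | add p q hp hq =>
    have : polyFun (p + q) = fun y => polyFun p y + polyFun q y := by
      funext y; simp [polyFun]
    rw [this]
    exact (hp.add hq).congr_fderiv (by simp [polyFun, add_smul, Finset.sum_add_distrib])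
  | mul_X p j hp =>
    have : polyFun (p * MvPolynomial.X j) = fun y => polyFun p y * y j := by
      funext y; simp [polyFun]
    rw [this]
    have hj : HasFDerivAt (fun y : E n => y j) (EuclideanSpace.proj (𝕜 := ℝ) j) x :=
      (EuclideanSpace.proj (𝕜 := ℝ) j : E n →L[ℝ] ℝ).hasFDerivAt
    refine (hp.mul hj).congr_fderiv ?_
    ext v
    simp [polyFun, MvPolynomial.pderiv_X, add_mul, Finset.sum_add_distrib, Finset.mul_sum,
      Pi.single_apply, apply_ite (MvPolynomial.eval (x : Fin n → ℝ))]
    exact Finset.sum_congr rfl fun i _ => by ring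

theorem contDiff_polyFun (P : MvPolynomial (Fin n) ℝ) {m : WithTop ℕ∞} :
    ContDiff ℝ m (polyFun P) := by
  induction P using MvPolynomial.induction_on with
  | C a =>
    have : polyFun (MvPolynomial.C a : MvPolynomial (Fin n) ℝ) = fun _ => a := by
      funext y; simp [polyFun]
    rw [this]
    exact contDiff_const
  | add p q hp hq =>
    have : polyFun (p + q) = fun y => polyFun p y + polyFun q y := by
      funext y; simp [polyFun]
    rw [this]
    exact hp.add hq
  | mul_X p j hp =>
    have : polyFun (p * MvPolynomial.X j) = fun y => polyFun p y * y j := by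
      funext y; simp [polyFun]
    rw [this]
    exact hp.mul (EuclideanSpace.proj (𝕜 := ℝ) j : E n →L[ℝ] ℝ).contDiff

theorem hessianMatrix_polyFun (P : MvPolynomial (Fin n) ℝ) (x : E n) (i j : Fin n) :
    hessianMatrix (polyFun P) x i j =
      polyFun (MvPolynomial.pderiv i (MvPolynomial.pderiv j P)) x := by
  have h1 : fderiv ℝ (polyFun P) = fun y =>
      ∑ i, polyFun (MvPolynomial.pderiv i P) y • (EuclideanSpace.proj (𝕜 := ℝ) i : E n →L[ℝ] ℝ) :=
    funext fun y => (hasFDerivAt_polyFun P y).fderiv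
  have h2 : HasFDerivAt (fderiv ℝ (polyFun P))
      (∑ i, (∑ j, polyFun (MvPolynomial.pderiv j (MvPolynomial.pderiv i P)) x •
        (EuclideanSpace.proj (𝕜 := ℝ) j : E n →L[ℝ] ℝ)).smulRight
          (EuclideanSpace.proj (𝕜 := ℝ) i : E n →L[ℝ] ℝ)) x := by
    rw [h1]
    exact HasFDerivAt.fun_sum fun i _ =>
      HasFDerivAt.smul_const (hasFDerivAt_polyFun (MvPolynomial.pderiv i P) x)
        (EuclideanSpace.proj (𝕜 := ℝ) i : E n →L[ℝ] ℝ)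
  rw [hessianMatrix, Matrix.of_apply, h2.fderiv]
  simp

/-- The symmetric matrix with entries `1/2` at `(i, j)` and at `(j, i)` (or `1` at `(i, i)`). -/
noncomputable def symUnit (i j : Fin n) : SymMat n :=
  ⟨(1 / 2 : ℝ) • (Matrix.single i j 1 + Matrix.single j i 1), by
    rw [selfAdjoint.mem_iff, star_smul, star_add, Matrix.star_eq_conjTranspose,
      Matrix.star_eq_conjTranspose, Matrix.conjTranspose_single, Matrix.conjTranspose_single,
      add_comm]
    simp⟩

/-- The family is redundant, as `(i, j)` and `(j, i)` give the same matrix. The factor `1/2`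
compensates for this, so sums may run over all pairs of indices. -/
theorem sum_smul_symUnit (X : SymMat n) :
    X = ∑ i, ∑ j, (X : Matrix (Fin n) (Fin n) ℝ) i j • symUnit i j := by
  apply Subtype.ext
  have hX : ∀ i j, (X : Matrix (Fin n) (Fin n) ℝ) i j = (X : Matrix (Fin n) (Fin n) ℝ) j i := by
    intro i j
    exact congrArg (fun M : Matrix (Fin n) (Fin n) ℝ => M i j) (selfAdjoint.mem_iff.1 X.2).symm
  ext a b
  simp only [AddSubgroup.val_finsetSum, selfAdjoint.val_smul, symUnit, Matrix.sum_apply,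
    Matrix.smul_apply, Matrix.add_apply, Matrix.single_apply, smul_eq_mul, mul_add,
    Finset.sum_add_distrib]
  simp only [ite_and, mul_ite, mul_one, mul_zero, Finset.sum_ite_eq',
    Finset.mem_univ, if_true, Finset.sum_ite_irrel, Finset.sum_const_zero]
  rw [hX b a]
  ring

theorem apply_eq_sum (L : SymMat n →ₗ[ℝ] ℝ) (X : SymMat n) :
    L X = ∑ i, ∑ j, L (symUnit i j) * (X : Matrix (Fin n) (Fin n) ℝ) i j := by
  conv_lhs => rw [sum_smul_symUnit X]
  simp only [map_sum, map_smul, smul_eq_mul, mul_comm]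

/-- The second order differential operator with constant coefficients `L` on polynomials. -/
noncomputable def polyOp (L : SymMat n →ₗ[ℝ] ℝ) :
    MvPolynomial (Fin n) ℝ →ₗ[ℝ] MvPolynomial (Fin n) ℝ :=
  ∑ i, ∑ j, L (symUnit i j) •
    ((MvPolynomial.pderiv i).toLinearMap ∘ₗ (MvPolynomial.pderiv j).toLinearMap)

theorem apply_hessian_polyFun (L : SymMat n →ₗ[ℝ] ℝ) (P : MvPolynomial (Fin n) ℝ)
    (h : ContDiff ℝ 2 (polyFun P)) (x : E n) :
    L (hessian (polyFun P) h x) = polyFun (polyOp L P) x := by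
  rw [apply_eq_sum]
  simp only [polyOp, polyFun, LinearMap.sum_apply, LinearMap.smul_apply, map_sum,
    MvPolynomial.smul_eval]
  refine Finset.sum_congr rfl fun i _ => Finset.sum_congr rfl fun j _ => ?_
  simp only [hessian, hessianMatrix_polyFun]
  rfl

/-- The polynomial `|x|²`. -/
noncomputable def normSqPoly (n : ℕ) : MvPolynomial (Fin n) ℝ :=
  ∑ i, MvPolynomial.X i * MvPolynomial.X i

theorem polyFun_normSqPoly (x : E n) : polyFun (normSqPoly n) x = ‖x‖ ^ 2 := by
  rw [EuclideanSpace.real_norm_sq_eq]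
  simp [polyFun, normSqPoly, pow_two]

theorem hessian_normSqPoly (h : ContDiff ℝ 2 (polyFun (normSqPoly n))) (x : E n) :
    hessian (polyFun (normSqPoly n)) h x = (2 : ℝ) • 1 := by
  apply Subtype.ext
  ext i j
  simp only [hessian, hessianMatrix_polyFun, normSqPoly, selfAdjoint.val_smul, Matrix.smul_apply,
    selfAdjoint.val_one]
  by_cases hij : i = j
  · subst hij
    simp [MvPolynomial.pderiv_X, polyFun, Pi.single_apply, mul_ite, Finset.sum_add_distrib]
    norm_num
  · have : (j = i) = False := by simp [eq_comm, hij]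
    simp [MvPolynomial.pderiv_X, polyFun, Pi.single_apply, mul_ite, Finset.sum_add_distrib, hij,
      this]

theorem IsEllipticFunctional.one_pos {L : SymMat n →ₗ[ℝ] ℝ} {lam : ℝ}
    (hL : IsEllipticFunctional L lam) (hn : 0 < n) : 0 < L 1 ∧ lam ≤ L 1 := by
  have h := hL.2 1 (by rw [selfAdjoint.val_one]; exact Matrix.PosSemidef.one)
  rw [selfAdjoint.val_one, Matrix.trace_one, Fintype.card_fin] at h
  have h1 : (1 : ℝ) ≤ n := by exact_mod_cast hn
  have h2 := hL.1
  constructor <;> nlinarith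

end Polynomial

/-! ### Comparison principle and the polynomial Dirichlet problem. -/

section Comparison

variable {n : ℕ} {L : SymMat n →ₗ[ℝ] ℝ} {lam : ℝ}

@[simp] theorem polyFun_add (P Q : MvPolynomial (Fin n) ℝ) (x : E n) :
    polyFun (P + Q) x = polyFun P x + polyFun Q x := by simp [polyFun]

@[simp] theorem polyFun_sub (P Q : MvPolynomial (Fin n) ℝ) (x : E n) :
    polyFun (P - Q) x = polyFun P x - polyFun Q x := by simp [polyFun]

@[simp] theorem polyFun_neg (P : MvPolynomial (Fin n) ℝ) (x : E n) :
    polyFun (-P) x = -polyFun P x := by simp [polyFun]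

@[simp] theorem polyFun_mul (P Q : MvPolynomial (Fin n) ℝ) (x : E n) :
    polyFun (P * Q) x = polyFun P x * polyFun Q x := by simp [polyFun]

@[simp] theorem polyFun_smul (c : ℝ) (P : MvPolynomial (Fin n) ℝ) (x : E n) :
    polyFun (c • P) x = c * polyFun P x := by simp [polyFun, MvPolynomial.smul_eval]

@[simp] theorem polyFun_C (c : ℝ) (x : E n) :
    polyFun (MvPolynomial.C c : MvPolynomial (Fin n) ℝ) x = c := by simp [polyFun]

@[simp] theorem polyFun_zero (x : E n) : polyFun (0 : MvPolynomial (Fin n) ℝ) x = 0 := by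
  simp [polyFun]

@[simp] theorem polyFun_one (x : E n) : polyFun (1 : MvPolynomial (Fin n) ℝ) x = 1 := by
  simp [polyFun]

theorem continuous_polyFun (P : MvPolynomial (Fin n) ℝ) : Continuous (polyFun P) :=
  (contDiff_polyFun P (m := 0)).continuous

theorem polyOp_C (L : SymMat n →ₗ[ℝ] ℝ) (c : ℝ) : polyOp L (MvPolynomial.C c) = 0 := by
  simp [polyOp]

theorem polyFun_polyOp_normSqPoly (L : SymMat n →ₗ[ℝ] ℝ) (x : E n) :
    polyFun (polyOp L (normSqPoly n)) x = 2 * L 1 := by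
  rw [← apply_hessian_polyFun L _ (contDiff_polyFun _), hessian_normSqPoly, map_smul, smul_eq_mul]

/-- Comparison of a viscosity supersolution with a smooth subsolution in the unit ball. -/
theorem IsViscositySupersolution.ge_of_ge_on_sphere (hn : 0 < n)
    (hL : IsEllipticFunctional L lam) {u : E n → EReal} (hu : IsViscositySupersolution L u)
    {g : E n → ℝ} (hg : ContDiff ℝ 2 g)
    (hsub : ∀ y ∈ Metric.ball (0 : E n) 1, 0 ≤ L (hessian g hg y))
    (hbd : ∀ y ∈ Metric.sphere (0 : E n) 1, (g y : EReal) ≤ u y) :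
    ∀ y ∈ Metric.closedBall (0 : E n) 1, (g y : EReal) ≤ u y := by
  intro z hz
  by_contra! hlt
  obtain ⟨c, hc1, hc2⟩ := EReal.lt_iff_exists_real_btwn.1 hlt
  rw [EReal.coe_lt_coe_iff] at hc2
  -- Adding `ε‖y‖²` makes `g` a strict subsolution, and subtracting `ε` leaves its values on the
  -- sphere unchanged. The difference of `u` and this perturbation is nonnegative on the sphere but
  -- at most `u z - c < 0` at `z`, so its minimum is interior.
  set ε := g z - c with hε
  have hε0 : 0 < ε := by linarith
  set Q : MvPolynomial (Fin n) ℝ := ε • normSqPoly n with hQ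
  have hQv : ∀ y, polyFun Q y = ε * ‖y‖ ^ 2 := fun y => by
    rw [hQ, polyFun_smul, polyFun_normSqPoly]
  have hcont : Continuous fun y => ε - g y - polyFun Q y :=
    (continuous_const.sub hg.continuous).sub (continuous_polyFun Q)
  have hlsc : LowerSemicontinuous fun y => u y + ((ε - g y - polyFun Q y : ℝ) : EReal) := by
    refine LowerSemicontinuous.add' hu.lsc
      (continuous_coe_real_ereal.comp hcont).lowerSemicontinuous fun y => ?_
    exact EReal.continuousAt_add (Or.inr (EReal.coe_ne_bot _)) (Or.inr (EReal.coe_ne_top _))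
  obtain ⟨z₀, hz₀, hmin⟩ := LowerSemicontinuousOn.exists_isMinOn ⟨z, hz⟩
    (isCompact_closedBall (0 : E n) 1) (hlsc.lowerSemicontinuousOn _)
  rw [isMinOn_iff] at hmin
  have hneg : u z + ((ε - g z - polyFun Q z : ℝ) : EReal) < 0 := by
    have h1 : ((ε - g z - polyFun Q z : ℝ) : EReal) ≤ ((-c : ℝ) : EReal) := by
      rw [EReal.coe_le_coe_iff, hQv]
      have := mul_nonneg hε0.le (sq_nonneg ‖z‖)
      rw [hε] at *
      linarith
    calc u z + ((ε - g z - polyFun Q z : ℝ) : EReal) ≤ u z + ((-c : ℝ) : EReal) := by gcongr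
      _ < c + ((-c : ℝ) : EReal) := EReal.add_lt_add_right_coe hc1 _
      _ = 0 := by rw [← EReal.coe_add]; simp
  have hneg₀ := (hmin z hz).trans_lt hneg
  have hu₀ : u z₀ ≠ ⊤ := by
    intro h
    rw [h, EReal.top_add_coe] at hneg₀
    exact absurd hneg₀ (by simp)
  obtain ⟨a, ha⟩ : ∃ a : ℝ, u z₀ = a := ⟨_, (EReal.coe_toReal hu₀ (hu.ne_bot z₀)).symm⟩
  have hball : z₀ ∈ Metric.ball (0 : E n) 1 := by
    rw [Metric.mem_ball]
    refine lt_of_le_of_ne (Metric.mem_closedBall.1 hz₀) fun h => ?_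
    have h1 := hbd z₀ h
    rw [dist_zero_right] at h
    rw [ha, hQv, h, ← EReal.coe_add] at hneg₀
    rw [ha, EReal.coe_le_coe_iff] at h1
    have : a + (ε - g z₀ - ε * 1 ^ 2) < 0 := by exact_mod_cast hneg₀
    linarith
  -- This constant makes `g + Q + k` touch `u` from below at `z₀`, where `L` of its Hessian is at
  -- least `2 ε L 1 > 0`.
  set k := a - g z₀ - polyFun Q z₀ with hk
  have hP : ContDiff ℝ 2 (polyFun (Q + MvPolynomial.C k)) := contDiff_polyFun _
  have hφ : ContDiff ℝ 2 (fun y => g y + polyFun (Q + MvPolynomial.C k) y) := hg.add hP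
  have htest := hu.test _ hφ z₀ (by rw [ha]; simp [hk]) (by
    filter_upwards [Metric.isOpen_ball.mem_nhds hball] with y hy
    have h1 := hmin y (Metric.ball_subset_closedBall hy)
    rw [ha, ← EReal.coe_add] at h1
    rw [polyFun_add, polyFun_C]
    induction hy' : u y with
    | bot => exact absurd hy' (hu.ne_bot y)
    | top => exact le_top
    | coe b =>
      rw [hy', ← EReal.coe_add, EReal.coe_le_coe_iff] at h1
      rw [EReal.coe_le_coe_iff, hk]
      linarith)
  rw [hessian_add hg hP, map_add, apply_hessian_polyFun, map_add, polyOp_C, add_zero, hQ,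
    map_smul, polyFun_smul, polyFun_polyOp_normSqPoly] at htest
  have h2 := hsub z₀ hball
  have h3 := mul_pos hε0 (mul_pos two_pos (hL.one_pos hn).1)
  linarith

/-- Smooth solutions of the linear equation are viscosity supersolutions. -/
theorem isViscositySupersolution_polyFun (hL : IsEllipticFunctional L lam)
    {P : MvPolynomial (Fin n) ℝ} (hP : polyOp L P = 0) :
    IsViscositySupersolution L (fun x => (polyFun P x : EReal)) where
  ne_bot _ := EReal.coe_ne_bot _
  lsc := (continuous_coe_real_ereal.comp (continuous_polyFun P)).lowerSemicontinuous
  dense_lt_top := by simp [EReal.coe_lt_top]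
  test φ hφ x₀ h₀ hle := by
    have hPn : ContDiff ℝ 2 (polyFun (-P)) := contDiff_polyFun _
    have hd : ContDiff ℝ 2 (fun x => φ x + polyFun (-P) x) := hφ.add hPn
    have hmax : IsLocalMax (fun x => φ x + polyFun (-P) x) x₀ := by
      filter_upwards [hle] with x hx
      rw [EReal.coe_le_coe_iff] at hx
      rw [EReal.coe_eq_coe_iff] at h₀
      simp only [polyFun_neg]
      linarith
    have h := hL.hessian_nonpos_of_isLocalMax hd hmax
    rwa [hessian_add hφ hPn, map_add, apply_hessian_polyFun, map_neg, hP, neg_zero, polyFun_zero,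
      add_zero] at h

/-- A smooth subsolution lies below a polynomial solution if it does so on the unit sphere. -/
theorem le_polyFun_of_le_on_sphere (hn : 0 < n) (hL : IsEllipticFunctional L lam)
    {P : MvPolynomial (Fin n) ℝ} (hP : polyOp L P = 0) {g : E n → ℝ} (hg : ContDiff ℝ 2 g)
    (hsub : ∀ y ∈ Metric.ball (0 : E n) 1, 0 ≤ L (hessian g hg y))
    (hbd : ∀ y ∈ Metric.sphere (0 : E n) 1, g y ≤ polyFun P y)
    {y : E n} (hy : y ∈ Metric.closedBall (0 : E n) 1) : g y ≤ polyFun P y := by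
  have := (isViscositySupersolution_polyFun hL hP).ge_of_ge_on_sphere hn hL hg hsub
    (fun y hy => EReal.coe_le_coe_iff.2 (hbd y hy)) y hy
  exact EReal.coe_le_coe_iff.1 this

theorem polyFun_le_of_le_on_sphere (hn : 0 < n) (hL : IsEllipticFunctional L lam)
    {P Q : MvPolynomial (Fin n) ℝ} (hP : polyOp L P = 0) (hQ : polyOp L Q = 0)
    (hbd : ∀ y ∈ Metric.sphere (0 : E n) 1, polyFun P y ≤ polyFun Q y)
    {y : E n} (hy : y ∈ Metric.closedBall (0 : E n) 1) : polyFun P y ≤ polyFun Q y :=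
  le_polyFun_of_le_on_sphere hn hL hQ (contDiff_polyFun P)
    (fun y _ => by rw [apply_hessian_polyFun, hP, polyFun_zero]) hbd hy

/-- The ball contains a box around the origin, and a polynomial vanishing on a product of infinite
sets is zero. -/
theorem eq_zero_of_polyFun_eq_zero_on_ball {P : MvPolynomial (Fin n) ℝ}
    (h : ∀ y ∈ Metric.ball (0 : E n) 1, polyFun P y = 0) : P = 0 := by
  have hopen : IsOpen ((WithLp.toLp 2 : (Fin n → ℝ) → E n) ⁻¹' Metric.ball (0 : E n) 1) :=
    Metric.isOpen_ball.preimage (PiLp.continuous_toLp 2 _)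
  obtain ⟨ε, hε, hsub⟩ := Metric.isOpen_iff.1 hopen 0 (by simp)
  refine MvPolynomial.funext_set (fun _ => Metric.ball (0 : ℝ) ε) (fun _ => ?_) fun x hx => ?_
  · rw [Real.ball_eq_Ioo]; exact Set.Ioo_infinite (by linarith)
  · have hx' : x ∈ Metric.ball (0 : Fin n → ℝ) ε := by
      rw [Metric.mem_ball, dist_pi_lt_iff hε]
      exact fun i => hx i trivial
    simpa [polyFun] using h _ (hsub hx')

theorem totalDegree_pderiv_le (i : Fin n) (q : MvPolynomial (Fin n) ℝ) :
    (MvPolynomial.pderiv i q).totalDegree ≤ q.totalDegree - 1 := by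
  refine Finset.sup_le fun m hm => ?_
  rw [MvPolynomial.mem_support_iff, MvPolynomial.coeff_pderiv] at hm
  have h := MvPolynomial.le_totalDegree (MvPolynomial.mem_support_iff.2 (left_ne_zero_of_mul hm))
  rw [Finsupp.sum_add_index' (by simp) (by simp), Finsupp.sum_single_index (by simp)] at h
  omega

/-- The Dirichlet problem with polynomial data on the unit sphere has a polynomial solution. -/
theorem exists_polyOp_eq_zero (hn : 0 < n) (hL : IsEllipticFunctional L lam)
    (P : MvPolynomial (Fin n) ℝ) : ∃ Q : MvPolynomial (Fin n) ℝ, polyOp L Q = 0 ∧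
      ∀ y ∈ Metric.sphere (0 : E n) 1, polyFun Q y = polyFun P y := by
  -- Look for `Q = P - (1 - |x|²) q`, which has the right boundary values for every `q`. The map `q
  -- ↦ L((1 - |x|²) q)` preserves degree at most `d`, and comparison with `0` makes it injective. It
  -- is then surjective in finite dimension, so `q` can be chosen with image `polyOp L P`.
  set d := P.totalDegree
  let V := MvPolynomial.restrictTotalDegree (Fin n) ℝ d
  let T₀ : MvPolynomial (Fin n) ℝ →ₗ[ℝ] MvPolynomial (Fin n) ℝ :=
    polyOp L ∘ₗ LinearMap.mulLeft ℝ (1 - normSqPoly n)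
  have hop : ∀ q : MvPolynomial (Fin n) ℝ, (polyOp L q).totalDegree ≤ q.totalDegree - 2 := by
    intro q
    simp only [polyOp, LinearMap.sum_apply, LinearMap.smul_apply]
    refine MvPolynomial.totalDegree_finsetSum_le fun i _ =>
      MvPolynomial.totalDegree_finsetSum_le fun j _ =>
      (MvPolynomial.totalDegree_smul_le _ _).trans ?_
    have h1 := totalDegree_pderiv_le j q
    have h2 := totalDegree_pderiv_le i (MvPolynomial.pderiv j q)
    exact h2.trans (by omega)
  have hns : (1 - normSqPoly n).totalDegree ≤ 2 := by
    refine (MvPolynomial.totalDegree_sub _ _).trans (max_le (by simp) ?_)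
    refine MvPolynomial.totalDegree_finsetSum_le fun i _ => ?_
    refine (MvPolynomial.totalDegree_mul _ _).trans (by simp)
  have hmap : ∀ q ∈ V, T₀ q ∈ V := by
    intro q hq
    rw [MvPolynomial.mem_restrictTotalDegree] at hq ⊢
    have h1 := hop ((1 - normSqPoly n) * q)
    have h2 := MvPolynomial.totalDegree_mul (1 - normSqPoly n) q
    change (polyOp L ((1 - normSqPoly n) * q)).totalDegree ≤ d
    omega
  have hns0 : (1 - normSqPoly n : MvPolynomial (Fin n) ℝ) ≠ 0 := by
    intro h
    have := congrArg (fun p => polyFun p (0 : E n)) h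
    simp [polyFun_normSqPoly] at this
  have hinj : Function.Injective (T₀.restrict hmap) := by
    rw [← LinearMap.ker_eq_bot, LinearMap.ker_eq_bot']
    rintro ⟨q, hq⟩ h0
    have h0' : polyOp L ((1 - normSqPoly n) * q) = 0 := congrArg Subtype.val h0
    have hs : ∀ y ∈ Metric.sphere (0 : E n) 1, polyFun ((1 - normSqPoly n) * q) y = 0 := by
      intro y hy
      rw [mem_sphere_zero_iff_norm] at hy
      simp [polyFun_normSqPoly, hy]
    have hz : (1 - normSqPoly n) * q = 0 := by
      refine eq_zero_of_polyFun_eq_zero_on_ball fun y hy => le_antisymm ?_ ?_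
      · simpa using polyFun_le_of_le_on_sphere hn hL h0' (map_zero (polyOp L))
          (fun y hy => by rw [hs y hy, polyFun_zero]) (Metric.ball_subset_closedBall hy)
      · simpa using polyFun_le_of_le_on_sphere hn hL (map_zero (polyOp L)) h0'
          (fun y hy => by rw [hs y hy, polyFun_zero]) (Metric.ball_subset_closedBall hy)
    exact Subtype.ext ((mul_eq_zero.1 hz).resolve_left hns0)
  obtain ⟨⟨q, hq⟩, hqP⟩ := LinearMap.injective_iff_surjective.1 hinj
    ⟨polyOp L P, by rw [MvPolynomial.mem_restrictTotalDegree]; have := hop P; omega⟩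
  have hqP' : polyOp L ((1 - normSqPoly n) * q) = polyOp L P := congrArg Subtype.val hqP
  refine ⟨P - (1 - normSqPoly n) * q, by rw [map_sub, hqP', sub_self], fun y hy => ?_⟩
  rw [mem_sphere_zero_iff_norm] at hy
  simp [polyFun_normSqPoly, hy]

end Comparison

/-! ### Harmonic measure on the unit sphere. -/

section HarmonicMeasure

variable {n : ℕ} {L : SymMat n →ₗ[ℝ] ℝ} {lam : ℝ}

/-- The unit sphere of `ℝⁿ`. -/
abbrev S (n : ℕ) : Type := Metric.sphere (0 : E n) 1

theorem nonempty_sphere (hn : 0 < n) : Nonempty (S n) := by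
  have : Nonempty (Fin n) := ⟨⟨0, hn⟩⟩
  exact (NormedSpace.sphere_nonempty.2 zero_le_one).to_subtype

/-- Restriction of polynomials to the unit sphere. -/
noncomputable def restrictSphere (n : ℕ) : MvPolynomial (Fin n) ℝ →ₐ[ℝ] C(S n, ℝ) :=
  MvPolynomial.aeval fun i => ⟨fun y => y.1 i, by fun_prop⟩

theorem restrictSphere_apply (P : MvPolynomial (Fin n) ℝ) (y : S n) :
    restrictSphere n P y = polyFun P y.1 := by
  induction P using MvPolynomial.induction_on with
  | C a => simp [restrictSphere, polyFun]
  | add p q hp hq => rw [map_add, ContinuousMap.add_apply, hp, hq, polyFun_add]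
  | mul_X p j hp =>
    rw [map_mul, ContinuousMap.mul_apply, hp, polyFun_mul]
    simp [restrictSphere, polyFun]

/-- A probability measure on the unit sphere representing the value at the center of polynomial
solutions of the equation with constant coefficients `L`. -/
structure IsHarmonicMeasure (L : SymMat n →ₗ[ℝ] ℝ) (σ : Measure (S n)) : Prop where
  prob : IsProbabilityMeasure σ
  integral_eq : ∀ P : MvPolynomial (Fin n) ℝ, polyOp L P = 0 →
    ∫ y, polyFun P y.1 ∂σ = polyFun P 0

/-- The maximum principle bounds the value at the center by the supremum on the sphere. The value is
thus a function of the boundary data, dominated by the sublinear functional `sup`, and Hahn–Banach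
extends it to all continuous functions; domination by `sup` forces positivity. -/
theorem exists_positive_functional (hn : 0 < n) (hL : IsEllipticFunctional L lam) :
    ∃ G : C(S n, ℝ) →ₗ[ℝ] ℝ, (∀ f : C(S n, ℝ), 0 ≤ f → 0 ≤ G f) ∧
      ∀ P : MvPolynomial (Fin n) ℝ, polyOp L P = 0 → G (restrictSphere n P) = polyFun P 0 := by
  have := nonempty_sphere hn
  let A := LinearMap.ker (polyOp L)
  let ρ : A →ₗ[ℝ] C(S n, ℝ) := (restrictSphere n).toLinearMap ∘ₗ A.subtype
  let ev : A →ₗ[ℝ] ℝ := (MvPolynomial.aeval (0 : Fin n → ℝ)).toLinearMap ∘ₗ A.subtype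
  have hev : ∀ P : A, ev P = polyFun P.1 0 := fun P => by
    simp [ev, polyFun, MvPolynomial.aeval_eq_eval]
  have hbound : ∀ (P : A) (c : ℝ), (∀ y, ρ P y ≤ c) → ev P ≤ c := by
    intro P c hc
    rw [hev]
    have := polyFun_le_of_le_on_sphere hn hL (LinearMap.mem_ker.1 P.2) (polyOp_C L c)
      (fun y hy => by rw [polyFun_C, ← restrictSphere_apply P.1 ⟨y, hy⟩]; exact hc ⟨y, hy⟩)
      (Metric.mem_closedBall_self zero_le_one)
    rwa [polyFun_C] at this
  have hker : LinearMap.ker ρ ≤ LinearMap.ker ev := by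
    intro P hP
    rw [LinearMap.mem_ker] at hP ⊢
    refine le_antisymm (hbound P 0 fun y => by rw [hP]; rfl) ?_
    have := hbound (-P) 0 fun y => by rw [map_neg, hP, neg_zero]; rfl
    rw [map_neg] at this
    linarith
  obtain ⟨g, hg⟩ : ∃ g : Module.Dual ℝ C(S n, ℝ), ρ.dualMap g = ev := by
    rw [← LinearMap.mem_range, LinearMap.range_dualMap_eq_dualAnnihilator_ker,
      Submodule.mem_dualAnnihilator]
    exact fun P hP => hker hP
  have hg' : ∀ P : A, g (ρ P) = ev P := fun P => congrArg (fun f => f P) hg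
  have hbdd : ∀ f : C(S n, ℝ), BddAbove (Set.range f) := fun f =>
    (isCompact_range f.continuous).bddAbove
  obtain ⟨G, hext, hG⟩ := exists_extension_of_le_sublinear
    (⟨LinearMap.range ρ, g.domRestrict _⟩ : C(S n, ℝ) →ₗ.[ℝ] ℝ) (fun f => ⨆ y, f y)
    (fun c hc f => by
      simp only [ContinuousMap.smul_apply, smul_eq_mul]
      exact (Real.mul_iSup_of_nonneg hc.le _).symm)
    (fun f h => ciSup_le fun y => add_le_add (le_ciSup (hbdd f) y) (le_ciSup (hbdd h) y))
    (fun ⟨f, hf⟩ => by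
      obtain ⟨P, rfl⟩ := hf
      change g (ρ P) ≤ ⨆ y, ρ P y
      rw [hg']
      exact hbound P _ fun y => le_ciSup (hbdd _) y)
  refine ⟨G, fun f hf => ?_, fun P hP => ?_⟩
  · have h1 := hG (-f)
    have h2 : ⨆ y, (-f) y ≤ 0 := ciSup_le fun y => neg_nonpos.2 (hf y)
    rw [map_neg] at h1
    linarith
  · have h1 := hext ⟨ρ ⟨P, hP⟩, LinearMap.mem_range_self _ _⟩
    have h2 : G (ρ ⟨P, hP⟩) = g (ρ ⟨P, hP⟩) := h1
    rw [hg', hev] at h2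
    exact h2

theorem exists_isHarmonicMeasure (hn : 0 < n) (hL : IsEllipticFunctional L lam) :
    ∃ σ : Measure (S n), IsHarmonicMeasure L σ := by
  obtain ⟨G, hpos, hG⟩ := exists_positive_functional hn hL
  let Λ₀ : CompactlySupportedContinuousMap (S n) ℝ →ₗ[ℝ] ℝ :=
    { toFun := fun f => G f.toContinuousMap
      map_add' := fun f h => map_add G f.toContinuousMap h.toContinuousMap
      map_smul' := fun c f => map_smul G c f.toContinuousMap }
  let Λ := PositiveLinearMap.mk₀ Λ₀ (fun f hf => hpos f.toContinuousMap hf)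
  let σ := RealRMK.rieszMeasure Λ
  have hσ : ∀ P : MvPolynomial (Fin n) ℝ, polyOp L P = 0 →
      ∫ y, polyFun P y.1 ∂σ = polyFun P 0 := fun P hP => by
    rw [← hG P hP]
    have h : ∫ y, restrictSphere n P y ∂σ = G (restrictSphere n P) :=
      RealRMK.integral_rieszMeasure Λ
        (CompactlySupportedContinuousMap.continuousMapEquiv (restrictSphere n P))
    simpa only [restrictSphere_apply] using h
  refine ⟨σ, ⟨?_, hσ⟩⟩
  -- Constants solve the equation, which fixes the total mass.
  have h1 := hσ 1 (by simpa using polyOp_C L 1)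
  simp only [polyFun_one, integral_const, smul_eq_mul, mul_one] at h1
  exact ⟨(ENNReal.toReal_eq_one_iff _).1 h1⟩

/-- Stone–Weierstrass approximates `f` by a polynomial on the sphere, and solving the Dirichlet
problem replaces it by a solution with the same boundary values. -/
theorem exists_polyOp_eq_zero_near (hn : 0 < n) (hL : IsEllipticFunctional L lam)
    {f : S n → ℝ} (hf : Continuous f) {ε : ℝ} (hε : 0 < ε) :
    ∃ P : MvPolynomial (Fin n) ℝ, polyOp L P = 0 ∧ ∀ y : S n, |polyFun P y.1 - f y| < ε := by
  have hsep : (restrictSphere n).range.SeparatesPoints := by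
    intro x y hxy
    obtain ⟨i, hi⟩ : ∃ i, x.1 i ≠ y.1 i := by
      by_contra! h
      exact hxy (Subtype.ext (PiLp.ext h))
    refine ⟨_, ⟨restrictSphere n (MvPolynomial.X i), ⟨MvPolynomial.X i, rfl⟩, rfl⟩, ?_⟩
    change restrictSphere n (MvPolynomial.X i) x ≠ restrictSphere n (MvPolynomial.X i) y
    rw [restrictSphere_apply, restrictSphere_apply]
    simpa [polyFun] using hi
  obtain ⟨⟨g, P, rfl⟩, hP⟩ :=
    ContinuousMap.exists_mem_subalgebra_near_continuous_of_separatesPoints _ hsep f hf ε hε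
  obtain ⟨Q, hQ, hQP⟩ := exists_polyOp_eq_zero hn hL P
  refine ⟨Q, hQ, fun y => ?_⟩
  rw [hQP y.1 y.2, ← restrictSphere_apply]
  exact hP y

/-- Continuous functions on the unit sphere are integrable. -/
theorem integrable_sphere {σ : Measure (S n)} [IsFiniteMeasure σ] {f : S n → ℝ}
    (hf : Continuous f) : Integrable f σ :=
  hf.integrable_of_hasCompactSupport (HasCompactSupport.of_compactSpace f)

theorem continuous_polyFun_sphere (P : MvPolynomial (Fin n) ℝ) :
    Continuous fun y : S n => polyFun P y.1 :=
  (continuous_polyFun P).comp continuous_subtype_val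

/-- The value at the center of a viscosity supersolution dominates the integrals of its continuous
minorants on the unit sphere. -/
theorem IsHarmonicMeasure.integral_le {σ : Measure (S n)} (hσ : IsHarmonicMeasure L σ)
    (hn : 0 < n) (hL : IsEllipticFunctional L lam) {u : E n → EReal}
    (hu : IsViscositySupersolution L u) {f : S n → ℝ} (hf : Continuous f)
    (hfu : ∀ y, (f y : EReal) ≤ u y.1) : ((∫ y, f y ∂σ : ℝ) : EReal) ≤ u 0 := by
  have := hσ.prob
  by_contra! hlt
  obtain ⟨c, hc1, hc2⟩ := EReal.lt_iff_exists_real_btwn.1 hlt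
  rw [EReal.coe_lt_coe_iff] at hc2
  set ε := ((∫ y, f y ∂σ) - c) / 2 with hε
  -- Approximating `f - ε` within `ε` keeps `P` below `f ≤ u` on the sphere and above `f - 2ε`,
  -- whose integral is `c`.
  obtain ⟨P, hP, hPf⟩ := exists_polyOp_eq_zero_near hn hL (hf.sub continuous_const)
    (ε := ε) (by rw [hε]; linarith) (f := fun y => f y - ε)
  have h0 : (polyFun P 0 : EReal) ≤ u 0 :=
    hu.ge_of_ge_on_sphere hn hL (contDiff_polyFun P)
      (fun y _ => by rw [apply_hessian_polyFun, hP, polyFun_zero])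
      (fun y hy => le_trans (EReal.coe_le_coe_iff.2 (by
        have := abs_lt.1 (hPf ⟨y, hy⟩); simp only at this; linarith)) (hfu ⟨y, hy⟩))
      0 (Metric.mem_closedBall_self zero_le_one)
  rw [← hσ.integral_eq P hP] at h0
  have h1 : ∫ y, (f y - 2 * ε) ∂σ ≤ ∫ y, polyFun P y.1 ∂σ :=
    integral_mono (integrable_sphere (hf.sub continuous_const))
      (integrable_sphere (continuous_polyFun_sphere P)) fun y => by
        have := abs_lt.1 (hPf y)
        simp only
        linarith
  rw [integral_sub (integrable_sphere hf) (integrable_const _)] at h1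
  simp only [integral_const, probReal_univ, smul_eq_mul, one_mul] at h1
  have h2 : c ≤ ∫ y, polyFun P y.1 ∂σ := by rw [hε] at h1; linarith
  exact absurd (hc1.trans_le (EReal.coe_le_coe_iff.2 h2)) (not_lt.2 h0)

/-- The value at the center of a smooth subsolution in the unit ball is at most its average. -/
theorem IsHarmonicMeasure.le_integral {σ : Measure (S n)} (hσ : IsHarmonicMeasure L σ)
    (hn : 0 < n) (hL : IsEllipticFunctional L lam) {g : E n → ℝ} (hg : ContDiff ℝ 2 g)
    (hsub : ∀ y ∈ Metric.ball (0 : E n) 1, 0 ≤ L (hessian g hg y)) :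
    g 0 ≤ ∫ y, g y.1 ∂σ := by
  have := hσ.prob
  have hgc : Continuous fun y : S n => g y.1 := hg.continuous.comp continuous_subtype_val
  refine le_of_forall_pos_le_add fun ε hε => ?_
  obtain ⟨P, hP, hPg⟩ := exists_polyOp_eq_zero_near hn hL (hgc.add continuous_const)
    (ε := ε / 2) (by linarith) (f := fun y => g y.1 + ε / 2)
  have h0 : g 0 ≤ polyFun P 0 := le_polyFun_of_le_on_sphere hn hL hP hg hsub
    (fun y hy => by have := abs_lt.1 (hPg ⟨y, hy⟩); simp only at this; linarith)
    (Metric.mem_closedBall_self zero_le_one)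
  rw [← hσ.integral_eq P hP] at h0
  have h1 : ∫ y, polyFun P y.1 ∂σ ≤ ∫ y, (g y.1 + ε) ∂σ :=
    integral_mono (integrable_sphere (continuous_polyFun_sphere P))
      (integrable_sphere (hgc.add continuous_const)) fun y => by
        have := abs_lt.1 (hPg y)
        simp only
        linarith
  rw [integral_add (integrable_sphere hgc) (integrable_const _)] at h1
  simp only [integral_const, probReal_univ, smul_eq_mul, one_mul] at h1
  linarith

/-- Harmonic measure charges all spherical caps that are nearly half spheres. -/
theorem IsHarmonicMeasure.exists_cap_pos {σ : Measure (S n)} (hσ : IsHarmonicMeasure L σ)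
    (hn : 0 < n) (hL : IsEllipticFunctional L lam) :
    ∃ t : ℝ, 0 < t ∧ ∀ e : E n, ‖e‖ = 1 → ¬ ∀ᵐ y ∂σ, inner ℝ e y.1 < t := by
  have := hσ.prob
  obtain ⟨hL1, hle⟩ := hL.one_pos hn
  set κ := lam / L 1 with hκ
  have hκ0 : 0 < κ := div_pos hL.1 hL1
  have hκ1 : κ ≤ 1 := (div_le_one hL1).2 hle
  -- With `s = ⟨e, y⟩`, the polynomial `s + s² - κ‖y‖²` is a subsolution vanishing at `0`, so its
  -- average is nonnegative. If `s < κ / 3` almost everywhere it is negative on the sphere: `s + s²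
  -- ≤ 0` for `-1 ≤ s ≤ 0`, and `s + s² ≤ 2s < κ` for `0 < s ≤ 1`.
  refine ⟨κ / 3, by positivity, fun e he hcap => ?_⟩
  set T : MvPolynomial (Fin n) ℝ := ∑ i, MvPolynomial.C (e i) * MvPolynomial.X i with hT
  have hTv : ∀ y : E n, polyFun T y = inner ℝ e y := fun y => by
    simp [hT, polyFun, PiLp.inner_apply, mul_comm]
  set Q := T + T * T - κ • normSqPoly n with hQ
  have hQv : ∀ y : E n, polyFun Q y = inner ℝ e y + inner ℝ e y * inner ℝ e y - κ * ‖y‖ ^ 2 :=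
    fun y => by rw [hQ]; simp [hTv, polyFun_normSqPoly]
  have hpT : ∀ i, MvPolynomial.pderiv i T = MvPolynomial.C (e i) := fun i => by
    simp [hT, MvPolynomial.pderiv_X, Pi.single_apply]
  let B : SymMat n := ⟨Matrix.vecMulVec e e, by
    rw [selfAdjoint.mem_iff]; ext i j; simp [Matrix.vecMulVec_apply, mul_comm]⟩
  have hB : lam ≤ L B := by
    have h1 : (B : Matrix (Fin n) (Fin n) ℝ).PosSemidef := by
      simpa [B] using Matrix.posSemidef_vecMulVec_self_star (e : Fin n → ℝ)
    have h2 := hL.2 B h1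
    have h3 : (B : Matrix (Fin n) (Fin n) ℝ).trace = 1 := by
      have h4 : ‖e‖ ^ 2 = 1 := by rw [he, one_pow]
      rw [EuclideanSpace.real_norm_sq_eq] at h4
      simpa [B, Matrix.trace, Matrix.vecMulVec_apply, pow_two] using h4
    rwa [h3, mul_one] at h2
  have hhess : ∀ y, L (hessian (polyFun Q) (contDiff_polyFun Q) y) = 2 * L B - κ * (2 * L 1) := by
    intro y
    have h1 : polyFun (polyOp L (T + T * T)) y = 2 * L B := by
      have h2 : hessian (polyFun (T + T * T)) (contDiff_polyFun _) y = (2 : ℝ) • B := by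
        apply Subtype.ext
        ext i j
        simp only [hessian, hessianMatrix_polyFun, selfAdjoint.val_smul, Matrix.smul_apply]
        simp [hpT, B, polyFun, Matrix.vecMulVec_apply]
        ring
      rw [← apply_hessian_polyFun L _ (contDiff_polyFun _), h2, map_smul, smul_eq_mul]
    rw [apply_hessian_polyFun, hQ, map_sub, polyFun_sub, h1, map_smul, polyFun_smul,
      polyFun_polyOp_normSqPoly]
  have hmean := hσ.le_integral hn hL (contDiff_polyFun Q) (fun y _ => by
    rw [hhess, hκ]
    have : lam / L 1 * (2 * L 1) = 2 * lam := by field_simp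
    linarith)
  rw [hQv 0] at hmean
  simp only [inner_zero_right, norm_zero] at hmean
  have hneg : ∀ᵐ y ∂σ, polyFun Q y.1 < 0 := by
    filter_upwards [hcap] with y hy
    have hy1 : ‖y.1‖ = 1 := by simp
    have h1 : |inner ℝ e y.1| ≤ 1 := by
      simpa [he, hy1] using abs_real_inner_le_norm e y.1
    rw [hQv, hy1]
    have h2 := (abs_le.1 h1).1
    rcases le_or_gt (inner ℝ e y.1) 0 with h3 | h3 <;> nlinarith
  have hlt : ∫ y, polyFun Q y.1 ∂σ < 0 := by
    have h1 := integral_pos_iff_support_of_nonneg_ae (μ := σ) (f := fun y => -polyFun Q y.1)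
      (by filter_upwards [hneg] with y hy; simpa using hy.le)
      (integrable_sphere (continuous_polyFun_sphere Q).neg)
    have h2 : 0 < ∫ y, -polyFun Q y.1 ∂σ := by
      rw [h1]
      have h3 : Function.support (fun y : S n => -polyFun Q y.1) =ᵐ[σ] Set.univ := by
        filter_upwards [hneg] with y hy
        exact propext ⟨fun _ => trivial, fun _ => neg_ne_zero.2 hy.ne⟩
      rw [measure_congr h3, measure_univ]
      exact one_pos
    rw [integral_neg] at h2
    linarith
  linarith

end HarmonicMeasure

/-! ### Integrals of lower semicontinuous functions. -/

/-- A bound for the integrals of the continuous minorants of a lower semicontinuous function is a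
bound for its integral. -/
theorem lintegral_le_of_forall_continuous_le {X : Type*} [MetricSpace X] [CompactSpace X]
    [MeasurableSpace X] [BorelSpace X] {σ : Measure X} [IsFiniteMeasure σ] {v : X → ℝ≥0∞}
    (hv : LowerSemicontinuous v) {U : ℝ≥0∞}
    (h : ∀ f : X → ℝ, Continuous f → (∀ y, 0 ≤ f y) → (∀ y, ENNReal.ofReal (f y) ≤ v y) →
      ENNReal.ofReal (∫ y, f y ∂σ) ≤ U) : ∫⁻ y, v y ∂σ ≤ U := by
  let 𝓕 : Set (X → ℝ≥0∞) := {g | ∃ f : X → ℝ, Continuous f ∧ (∀ y, 0 ≤ f y) ∧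
    (g = fun y => ENNReal.ofReal (f y)) ∧ g ≤ v}
  have hcont : ∀ g ∈ 𝓕, Continuous g := by
    rintro g ⟨f, hf, -, rfl, -⟩
    exact ENNReal.continuous_ofReal.comp hf
  have hzero : (fun _ => 0) ∈ 𝓕 :=
    ⟨fun _ => 0, continuous_const, fun _ => le_rfl, by simp, fun _ => zero_le⟩
  have hsup : ∀ g₁ ∈ 𝓕, ∀ g₂ ∈ 𝓕, g₁ ⊔ g₂ ∈ 𝓕 := by
    rintro g₁ ⟨f₁, hf₁, h₁, rfl, hv₁⟩ g₂ ⟨f₂, hf₂, h₂, rfl, hv₂⟩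
    refine ⟨fun y => max (f₁ y) (f₂ y), hf₁.max hf₂, fun y => le_max_of_le_left (h₁ y), ?_,
      sup_le hv₁ hv₂⟩
    funext y
    exact (ENNReal.ofReal_max _ _).symm
  have hint : ∀ g ∈ 𝓕, ∫⁻ y, g y ∂σ ≤ U := by
    rintro g ⟨f, hf, h0, rfl, hle⟩
    rw [← ofReal_integral_eq_lintegral_ofReal
      (hf.integrable_of_hasCompactSupport (HasCompactSupport.of_compactSpace f))
      (Filter.Eventually.of_forall h0)]
    exact h f hf h0 hle
  have hlub : IsLUB 𝓕 v := by
    refine ⟨fun g hg => by obtain ⟨f, -, -, -, hle⟩ := hg; exact hle, fun e he x => ?_⟩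
    refine le_of_forall_lt fun c hc => ?_
    obtain ⟨d, hcd, hdv⟩ := exists_between hc
    refine hcd.trans_le ?_
    have hd : d ≠ ⊤ := hdv.ne_top
    obtain ⟨δ, hδ, hball⟩ := Metric.eventually_nhds_iff.1 (hv x d hdv)
    -- A tent of height `d` at `x`, vanishing outside the ball on which `v` exceeds `d`.
    have hf : Continuous fun y => d.toReal * max 0 (1 - dist y x / δ) := by fun_prop
    have hmem : (fun y => ENNReal.ofReal (d.toReal * max 0 (1 - dist y x / δ))) ∈ 𝓕 := by
      refine ⟨_, hf, fun y => by positivity, rfl, fun y => ?_⟩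
      by_cases hy : dist y x < δ
      · refine le_trans ?_ (hball hy).le
        rw [← ENNReal.ofReal_toReal hd]
        refine ENNReal.ofReal_le_ofReal ?_
        rw [ENNReal.toReal_ofReal ENNReal.toReal_nonneg]
        have h1 : 0 ≤ dist y x / δ := by positivity
        exact mul_le_of_le_one_right ENNReal.toReal_nonneg (max_le zero_le_one (by linarith))
      · have h1 : 1 ≤ dist y x / δ := (one_le_div hδ).2 (not_lt.1 hy)
        simp only
        rw [max_eq_left (by linarith), mul_zero, ENNReal.ofReal_zero]
        exact zero_le
    have := he hmem x
    simpa [ENNReal.ofReal_toReal hd] using this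
  -- A countable subfamily has the same supremum. Inserting `0` makes it nonempty, so it can be
  -- enumerated, and finite suprema stay in `𝓕`; monotone convergence then applies.
  obtain ⟨𝓖, hsub, hcount, hlub'⟩ := exists_countable_lowerSemicontinuous_isLUB
    (fun g hg => (hcont g hg).lowerSemicontinuous) hlub
  obtain ⟨g, hg⟩ := (hcount.insert (fun _ => 0)).exists_eq_range (Set.insert_nonempty _ _)
  have hgF : ∀ k, g k ∈ 𝓕 := fun k => by
    have : g k ∈ insert (fun _ => 0) 𝓖 := hg ▸ Set.mem_range_self k
    rcases this with h0 | h0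
    · rw [h0]; exact hzero
    · exact hsub h0
  have hps : ∀ k, partialSups g k ∈ 𝓕 := fun k => by
    induction k with
    | zero => simpa using hgF 0
    | succ k ih => rw [partialSups_add_one]; exact hsup _ ih _ (hgF _)
  have hle : ∀ y, v y ≤ ⨆ k, partialSups g k y := by
    refine hlub'.2 fun f hf => ?_
    have : f ∈ Set.range g := hg ▸ Set.mem_insert_of_mem _ hf
    obtain ⟨k, rfl⟩ := this
    exact fun y => le_iSup_of_le k (le_partialSups g k y)
  calc ∫⁻ y, v y ∂σ ≤ ∫⁻ y, ⨆ k, partialSups g k y ∂σ := lintegral_mono hle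
    _ = ⨆ k, ∫⁻ y, partialSups g k y ∂σ :=
      lintegral_iSup (fun k => (hcont _ (hps k)).measurable) (partialSups g).monotone
    _ ≤ U := iSup_le fun k => hint _ (hps k)

/-! ### The mean value inequality for supersolutions. -/

section MeanValue

variable {n : ℕ} {L : SymMat n →ₗ[ℝ] ℝ} {lam : ℝ}

theorem exists_neg_le_of_lowerSemicontinuous {u : E n → EReal} (hbot : ∀ x, u x ≠ ⊥)
    (hlsc : LowerSemicontinuous u) {s : Set (E n)} (hs : IsCompact s) :
    ∃ K : ℝ, 0 ≤ K ∧ ∀ y ∈ s, ((-K : ℝ) : EReal) ≤ u y := by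
  rcases s.eq_empty_or_nonempty with rfl | hne
  · exact ⟨0, le_rfl, by simp⟩
  obtain ⟨a, -, hmin⟩ := LowerSemicontinuousOn.exists_isMinOn hne hs (hlsc.lowerSemicontinuousOn s)
  rw [isMinOn_iff] at hmin
  obtain ⟨b, -, hb⟩ := EReal.lt_iff_exists_real_btwn.1 (bot_lt_iff_ne_bot.2 (hbot a))
  refine ⟨|b|, abs_nonneg b, fun y hy => le_trans ?_ (hb.le.trans (hmin y hy))⟩
  rw [EReal.coe_le_coe_iff]
  exact neg_abs_le b

theorem toENNReal_add_toENNReal_neg {a : EReal} {K : ℝ} (hK : 0 ≤ K)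
    (ha : ((-K : ℝ) : EReal) ≤ a) :
    (a + (K : EReal)).toENNReal + (-a).toENNReal = a.toENNReal + ENNReal.ofReal K := by
  induction a with
  | bot => simp at ha
  | top => simp
  | coe b =>
    rw [EReal.coe_le_coe_iff] at ha
    rw [← EReal.coe_add, ← EReal.coe_neg]
    simp only [EReal.real_coe_toENNReal]
    rcases le_total 0 b with hb | hb
    · rw [ENNReal.ofReal_add hb hK, ENNReal.ofReal_of_nonpos (neg_nonpos.2 hb), add_zero]
    · rw [ENNReal.ofReal_of_nonpos hb, zero_add,
        ← ENNReal.ofReal_add (by linarith) (by linarith)]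
      congr 1
      ring

/-- Positive and negative parts are placed on opposite sides so that no infinities are subtracted.
On the closed ball `u + K ≥ 0` for some real `K`, so `u + K` is an increasing limit of nonnegative
continuous minorants on the sphere, to which `integral_le` applies; finally `K` cancels. -/
theorem IsHarmonicMeasure.lintegral_le_center {σ : Measure (S n)} (hσ : IsHarmonicMeasure L σ)
    (hn : 0 < n) (hL : IsEllipticFunctional L lam) {u : E n → EReal}
    (hu : IsViscositySupersolution L u) :
    ∫⁻ y, (u y.1).toENNReal ∂σ + (-u 0).toENNReal ≤
      (u 0).toENNReal + ∫⁻ y, (-u y.1).toENNReal ∂σ := by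
  have := hσ.prob
  obtain ⟨K, hK, hKu⟩ := exists_neg_le_of_lowerSemicontinuous hu.ne_bot hu.lsc
    (isCompact_closedBall (0 : E n) 1)
  have hKS : ∀ y : S n, ((-K : ℝ) : EReal) ≤ u y.1 := fun y =>
    hKu _ (Metric.sphere_subset_closedBall y.2)
  have hK0 := hKu 0 (Metric.mem_closedBall_self zero_le_one)
  have hum : Measurable fun y : S n => u y.1 := hu.lsc.measurable.comp measurable_subtype_coe
  have hlsc : LowerSemicontinuous fun y : S n => (u y.1 + (K : EReal)).toENNReal := by
    refine EReal.continuous_toENNReal.comp_lowerSemicontinuous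
      (g := EReal.toENNReal) ?_ fun a b hab => EReal.toENNReal_le_toENNReal hab
    refine LowerSemicontinuous.add' (LowerSemicontinuous.comp hu.lsc continuous_subtype_val)
      lowerSemicontinuous_const fun y => ?_
    exact EReal.continuousAt_add (Or.inr (EReal.coe_ne_bot _)) (Or.inr (EReal.coe_ne_top _))
  have hmain : ∫⁻ y, (u y.1 + (K : EReal)).toENNReal ∂σ ≤ (u 0 + (K : EReal)).toENNReal := by
    refine lintegral_le_of_forall_continuous_le hlsc fun f hf h0 hle => ?_
    have h1 := hσ.integral_le hn hL hu (f := fun y => f y - K) (hf.sub continuous_const)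
      fun y => by
        have h2 := hle y
        induction hy : u y.1 with
        | bot => exact absurd hy (hu.ne_bot _)
        | top => exact le_top
        | coe b =>
          have h3 := hKS y
          rw [hy, EReal.coe_le_coe_iff] at h3
          rw [hy, ← EReal.coe_add, EReal.real_coe_toENNReal,
            ENNReal.ofReal_le_ofReal_iff (by linarith)] at h2
          rw [EReal.coe_le_coe_iff]
          linarith
    rw [integral_sub (integrable_sphere hf) (integrable_const _)] at h1
    simp only [integral_const, probReal_univ, smul_eq_mul, one_mul] at h1
    rw [← EReal.real_coe_toENNReal]
    refine EReal.toENNReal_le_toENNReal ?_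
    calc ((∫ y, f y ∂σ : ℝ) : EReal) = ((∫ y, f y ∂σ - K : ℝ) : EReal) + (K : EReal) := by
          rw [← EReal.coe_add]; simp
      _ ≤ u 0 + (K : EReal) := by gcongr
  have hsum : ∫⁻ y, (u y.1 + (K : EReal)).toENNReal ∂σ + ∫⁻ y, (-u y.1).toENNReal ∂σ =
      ∫⁻ y, (u y.1).toENNReal ∂σ + ENNReal.ofReal K := by
    have hm : Measurable fun y : S n => (-u y.1).toENNReal :=
      (continuous_neg.measurable.comp hum).ereal_toENNReal
    rw [← lintegral_add_right _ hm]
    simp_rw [toENNReal_add_toENNReal_neg hK (hKS _)]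
    rw [lintegral_add_right _ measurable_const, lintegral_const, measure_univ, mul_one]
  have hcancel : ENNReal.ofReal K ≠ ⊤ := ENNReal.ofReal_ne_top
  refine (ENNReal.add_le_add_iff_right hcancel).1 ?_
  calc ∫⁻ y, (u y.1).toENNReal ∂σ + (-u 0).toENNReal + ENNReal.ofReal K
      = (∫⁻ y, (u y.1).toENNReal ∂σ + ENNReal.ofReal K) + (-u 0).toENNReal := by
        rw [add_right_comm]
    _ = ∫⁻ y, (u y.1 + (K : EReal)).toENNReal ∂σ + ∫⁻ y, (-u y.1).toENNReal ∂σ +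
        (-u 0).toENNReal := by rw [hsum]
    _ ≤ (u 0 + (K : EReal)).toENNReal + ∫⁻ y, (-u y.1).toENNReal ∂σ + (-u 0).toENNReal := by
        gcongr
    _ = ((u 0 + (K : EReal)).toENNReal + (-u 0).toENNReal) + ∫⁻ y, (-u y.1).toENNReal ∂σ := by
        rw [add_right_comm]
    _ = (u 0).toENNReal + ∫⁻ y, (-u y.1).toENNReal ∂σ + ENNReal.ofReal K := by
        rw [toENNReal_add_toENNReal_neg hK hK0, add_right_comm]

theorem IsViscositySupersolution.comp_affine {u : E n → EReal}
    (hu : IsViscositySupersolution L u) (x : E n) {r : ℝ} (hr : 0 < r) :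
    IsViscositySupersolution L fun y => u (x + r • y) where
  ne_bot _ := hu.ne_bot _
  lsc := LowerSemicontinuous.comp hu.lsc (by fun_prop)
  dense_lt_top := by
    let e : E n ≃ₜ E n := (Homeomorph.smulOfNeZero r hr.ne').trans (Homeomorph.addLeft x)
    exact hu.dense_lt_top.preimage e.isOpenMap
  test φ hφ y₀ h₀ hle := by
    have hinv : ∀ y : E n, -(r⁻¹ • x) + r⁻¹ • (x + r • y) = y := fun y => by
      rw [smul_add, smul_smul, inv_mul_cancel₀ hr.ne', one_smul, neg_add_cancel_left]
    have hinv' : ∀ z : E n, x + r • (-(r⁻¹ • x) + r⁻¹ • z) = z := fun z => by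
      rw [smul_add, smul_neg, smul_smul, smul_smul, mul_inv_cancel₀ hr.ne', one_smul, one_smul,
        add_neg_cancel_left]
    have hφ' : ContDiff ℝ 2 fun z => φ (-(r⁻¹ • x) + r⁻¹ • z) :=
      hφ.comp (contDiff_const.add (contDiff_id.const_smul r⁻¹))
    have h := hu.test _ hφ' (x + r • y₀) (by simp only [hinv]; exact h₀) (by
      have hc : Filter.Tendsto (fun z : E n => -(r⁻¹ • x) + r⁻¹ • z) (𝓝 (x + r • y₀)) (𝓝 y₀) := by
        have : Continuous fun z : E n => -(r⁻¹ • x) + r⁻¹ • z := by fun_prop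
        simpa only [hinv] using this.tendsto (x + r • y₀)
      filter_upwards [hc.eventually hle] with z hz
      simpa only [hinv'] using hz)
    rw [hessian_comp_affine hφ, hinv, map_smul, smul_eq_mul] at h
    exact nonpos_of_mul_nonpos_right h (by positivity)

/-- The mean value inequality for viscosity supersolutions, in terms of positive and negative
parts. -/
theorem IsHarmonicMeasure.lintegral_le {σ : Measure (S n)} (hσ : IsHarmonicMeasure L σ)
    (hn : 0 < n) (hL : IsEllipticFunctional L lam) {u : E n → EReal}
    (hu : IsViscositySupersolution L u) (x : E n) {r : ℝ} (hr : 0 < r) :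
    ∫⁻ y, (u (x + r • y.1)).toENNReal ∂σ + (-u x).toENNReal ≤
      (u x).toENNReal + ∫⁻ y, (-u (x + r • y.1)).toENNReal ∂σ := by
  simpa using hσ.lintegral_le_center hn hL (hu.comp_affine x hr)

end MeanValue

/-! ### Convolutions: mean value inequality, semicontinuity, finiteness and the viscosity test. -/

section Convolution

variable {n : ℕ} {L : SymMat n →ₗ[ℝ] ℝ} {lam : ℝ} {u : E n → EReal} {μ : Measure (E n)}

/-- The convolution of the positive part of `u` with `μ`. -/
noncomputable def posConv (u : E n → EReal) (μ : Measure (E n)) (x : E n) : ℝ≥0∞ :=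
  ∫⁻ y, (u (x - y)).toENNReal ∂μ

/-- The convolution of the negative part of `u` with `μ`. -/
noncomputable def negConv (u : E n → EReal) (μ : Measure (E n)) (x : E n) : ℝ≥0∞ :=
  ∫⁻ y, (-u (x - y)).toENNReal ∂μ

theorem convMeasure_eq (u : E n → EReal) (μ : Measure (E n)) (x : E n) :
    convMeasure u μ x = (posConv u μ x : EReal) - (negConv u μ x : EReal) := rfl

/-- The negative part of `u(x - y)` is bounded by a `μ`-integrable function of `y`, locally
uniformly in `x`. -/
def HasDominatedNegPart (u : E n → EReal) (μ : Measure (E n)) : Prop :=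
  ∀ R : ℝ, 0 < R → ∃ C : E n → ℝ≥0∞, AEMeasurable C μ ∧ ∫⁻ y, C y ∂μ ≠ ⊤ ∧
    ∀ᵐ y ∂μ, ∀ x ∈ Metric.ball (0 : E n) R, (-u (x - y)).toENNReal ≤ C y

theorem HasDominatedNegPart.negConv_le (h : HasDominatedNegPart u μ) {R : ℝ} (hR : 0 < R) :
    ∃ K : ℝ≥0∞, K ≠ ⊤ ∧ ∀ x ∈ Metric.ball (0 : E n) R, negConv u μ x ≤ K := by
  obtain ⟨C, -, hK, hC⟩ := h R hR
  exact ⟨_, hK, fun x hx => lintegral_mono_ae (hC.mono fun y hy => hy x hx)⟩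

theorem mem_ball_norm_add_one (x : E n) : x ∈ Metric.ball (0 : E n) (‖x‖ + 1) := by
  rw [mem_ball_zero_iff]
  linarith

theorem HasDominatedNegPart.negConv_ne_top (h : HasDominatedNegPart u μ) (x : E n) :
    negConv u μ x ≠ ⊤ := by
  obtain ⟨K, hK, hle⟩ := h.negConv_le (R := ‖x‖ + 1) (by positivity)
  exact ne_top_of_le_ne_top hK (hle x (mem_ball_norm_add_one x))

theorem coe_sub_ne_bot {a b : ℝ≥0∞} (hb : b ≠ ⊤) : (a : EReal) - (b : EReal) ≠ ⊥ := by
  lift b to NNReal using hb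
  induction a with
  | top => simp
  | coe a => exact EReal.coe_ne_bot ((a : ℝ) - (b : ℝ))

theorem measurable_posPart (hu : LowerSemicontinuous u) :
    Measurable fun q : E n × E n => (u (q.1 - q.2)).toENNReal :=
  (hu.measurable.comp (measurable_fst.sub measurable_snd)).ereal_toENNReal

theorem measurable_negPart (hu : LowerSemicontinuous u) :
    Measurable fun q : E n × E n => (-u (q.1 - q.2)).toENNReal :=
  (continuous_neg.measurable.comp
    (hu.measurable.comp (measurable_fst.sub measurable_snd))).ereal_toENNReal

theorem measurable_posConv [SFinite μ] (hu : LowerSemicontinuous u) : Measurable (posConv u μ) :=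
  (measurable_posPart hu).lintegral_prod_right'

theorem IsHarmonicMeasure.lintegral_posConv_le [SFinite μ] {σ : Measure (S n)}
    (hσ : IsHarmonicMeasure L σ) (hn : 0 < n) (hL : IsEllipticFunctional L lam)
    (hu : IsViscositySupersolution L u) (x : E n) {r : ℝ} (hr : 0 < r) :
    ∫⁻ y, posConv u μ (x + r • y.1) ∂σ + negConv u μ x ≤
      posConv u μ x + ∫⁻ y, negConv u μ (x + r • y.1) ∂σ := by
  have := hσ.prob
  have hmeas : Measurable fun q : S n × E n => ((x + r • q.1.1 : E n), q.2) := by fun_prop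
  have hp : Measurable fun q : S n × E n => (u (x + r • q.1.1 - q.2)).toENNReal :=
    (measurable_posPart hu.lsc).comp hmeas
  have hm : Measurable fun q : S n × E n => (-u (x + r • q.1.1 - q.2)).toENNReal :=
    (measurable_negPart hu.lsc).comp hmeas
  have hswp : ∫⁻ y, posConv u μ (x + r • y.1) ∂σ =
      ∫⁻ z, ∫⁻ y, (u (x + r • y.1 - z)).toENNReal ∂σ ∂μ :=
    lintegral_lintegral_swap hp.aemeasurable
  have hswm : ∫⁻ y, negConv u μ (x + r • y.1) ∂σ =
      ∫⁻ z, ∫⁻ y, (-u (x + r • y.1 - z)).toENNReal ∂σ ∂μ :=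
    lintegral_lintegral_swap hm.aemeasurable
  have hpx : Measurable fun z => (u (x - z)).toENNReal :=
    (measurable_posPart hu.lsc).comp measurable_prodMk_left
  have hmx : Measurable fun z => (-u (x - z)).toENNReal :=
    (measurable_negPart hu.lsc).comp measurable_prodMk_left
  rw [hswp, hswm]
  unfold posConv negConv
  rw [← lintegral_add_right _ hmx, ← lintegral_add_left hpx]
  refine lintegral_mono fun z => ?_
  have h := hσ.lintegral_le hn hL hu (x - z) hr
  simpa only [sub_add_eq_add_sub] using h

/-- Adding the dominating function `C` makes the integrand nonnegative, so Fatou's lemma applies.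
Near `x₀` the convolution differs from the resulting integral by the finite constant `∫ C`. -/
theorem lowerSemicontinuous_convMeasure (hu : LowerSemicontinuous u)
    (h : HasDominatedNegPart u μ) : LowerSemicontinuous (convMeasure u μ) := by
  intro x₀
  obtain ⟨C, hCm, hK, hC⟩ := h (‖x₀‖ + 1) (by positivity)
  set K := ∫⁻ y, C y ∂μ
  -- This is `u(x - y) + C y` where `C` is finite and dominates the negative part; truncated
  -- subtraction is then exact.
  let G : E n → E n → ℝ≥0∞ := fun x y =>
    (u (x - y)).toENNReal + (C y - (-u (x - y)).toENNReal)
  have hpx : ∀ x, Measurable fun z => (u (x - z)).toENNReal := fun x =>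
    (measurable_posPart hu).comp measurable_prodMk_left
  have hmx : ∀ x, Measurable fun z => (-u (x - z)).toENNReal := fun x =>
    (measurable_negPart hu).comp measurable_prodMk_left
  have hGm : ∀ x, AEMeasurable (G x) μ := fun x =>
    (hpx x).aemeasurable.add (hCm.sub (hmx x).aemeasurable)
  have hCfin : ∀ᵐ y ∂μ, C y < ⊤ := ae_lt_top' hCm hK
  have hlsc : LowerSemicontinuousAt (fun x => ∫⁻ y, G x y ∂μ) x₀ := by
    rw [lowerSemicontinuousAt_iff_le_liminf]
    refine le_trans (lintegral_mono_ae ?_) (lintegral_liminf_le' hGm)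
    filter_upwards [hCfin] with y hy
    refine (lowerSemicontinuousAt_iff_le_liminf (f := fun x => G x y)).1 ?_
    have hΦ : Continuous fun t : EReal => t.toENNReal + (C y - (-t).toENNReal) :=
      EReal.continuous_toENNReal.add
        ((ENNReal.continuous_sub_left hy.ne).comp (EReal.continuous_toENNReal.comp continuous_neg))
    have hmono : Monotone fun t : EReal => t.toENNReal + (C y - (-t).toENNReal) :=
      fun s t hst => add_le_add (EReal.toENNReal_le_toENNReal hst)
        (tsub_le_tsub_left (EReal.toENNReal_le_toENNReal (EReal.neg_le_neg_iff.2 hst)) _)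
    have hshift : LowerSemicontinuous fun x => u (x - y) :=
      LowerSemicontinuous.comp hu (by fun_prop)
    exact hΦ.comp_lowerSemicontinuous hshift hmono x₀
  have hsum : ∀ x ∈ Metric.ball (0 : E n) (‖x₀‖ + 1),
      ∫⁻ y, G x y ∂μ + negConv u μ x = posConv u μ x + K := by
    intro x hx
    unfold posConv negConv
    rw [← lintegral_add_right _ (hmx x), ← lintegral_add_left (hpx x)]
    refine lintegral_congr_ae ?_
    filter_upwards [hC] with y hy
    simp only [G]
    rw [add_assoc, tsub_add_cancel_of_le (hy x hx)]
  have heq : ∀ x ∈ Metric.ball (0 : E n) (‖x₀‖ + 1),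
      convMeasure u μ x = ((∫⁻ y, G x y ∂μ : ℝ≥0∞) : EReal) - (K : EReal) := by
    intro x hx
    rw [convMeasure_eq]
    have h1 := hsum x hx
    have h2 := h.negConv_ne_top x
    generalize posConv u μ x = P at *
    generalize negConv u μ x = N at *
    generalize ∫⁻ y, G x y ∂μ = g at *
    generalize K = K at *
    lift N to NNReal using h2
    lift K to NNReal using hK
    induction P with
    | top =>
      have : g = ⊤ := by simpa using h1
      rw [this]
      rfl
    | coe P =>
      have hg : g ≠ ⊤ := by
        rintro rfl
        rw [top_add, ← ENNReal.coe_add] at h1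
        exact ENNReal.coe_ne_top h1.symm
      lift g to NNReal using hg
      have h3 : (g : ℝ) + N = P + K := by exact_mod_cast h1
      change (((P : ℝ) - (N : ℝ) : ℝ) : EReal) = (((g : ℝ) - (K : ℝ) : ℝ) : EReal)
      congr 1
      linarith
  have hΨ : Continuous fun t : ℝ≥0∞ => (t : EReal) - (K : EReal) := by
    have hKr : (K : EReal) = ((K.toReal : ℝ) : EReal) := (EReal.coe_ennreal_toReal hK).symm
    rw [hKr]
    simp only [sub_eq_add_neg]
    refine continuous_iff_continuousAt.2 fun t => ?_
    have h1 : ContinuousAt (fun p : EReal × EReal => p.1 + p.2)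
        ((t : EReal), -((K.toReal : ℝ) : EReal)) :=
      EReal.continuousAt_add (Or.inr (EReal.coe_ne_bot _)) (Or.inr (EReal.coe_ne_top _))
    exact ContinuousAt.comp (f := fun t : ℝ≥0∞ => ((t : EReal), -((K.toReal : ℝ) : EReal))) h1
      (continuous_coe_ennreal_ereal.prodMk continuous_const).continuousAt
  have hΨm : Monotone fun t : ℝ≥0∞ => (t : EReal) - (K : EReal) := fun s t hst =>
    EReal.sub_le_sub (EReal.coe_ennreal_le_coe_ennreal_iff.2 hst) le_rfl
  have hfin := hΨ.continuousAt.comp_lowerSemicontinuousAt hlsc hΨm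
  intro c hc
  rw [heq x₀ (mem_ball_norm_add_one x₀)] at hc
  filter_upwards [hfin c hc, Metric.isOpen_ball.mem_nhds (mem_ball_norm_add_one x₀)] with x hx hxb
  rw [heq x hxb]
  exact hx

theorem HasDominatedNegPart.lintegral_negConv_ne_top {σ : Measure (S n)} [IsProbabilityMeasure σ]
    (h : HasDominatedNegPart u μ) (x : E n) {r : ℝ} (hr : 0 < r) :
    ∫⁻ y, negConv u μ (x + r • y.1) ∂σ ≠ ⊤ := by
  obtain ⟨K, hK, hle⟩ := h.negConv_le (R := ‖x‖ + r + 1) (by positivity)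
  refine ne_top_of_le_ne_top hK ?_
  calc ∫⁻ y, negConv u μ (x + r • y.1) ∂σ ≤ ∫⁻ _, K ∂σ := lintegral_mono fun y => hle _ (by
        rw [mem_ball_zero_iff]
        have h1 : ‖y.1‖ = 1 := by simp
        have h2 := norm_add_le x (r • y.1)
        rw [norm_smul, h1, Real.norm_of_nonneg hr.le] at h2
        linarith)
    _ = K := by simp

/-- Finiteness at `x` forces finiteness at `σ`-almost every point of each sphere about `x`. If a
ball around `z` contained no finite point, take `x` nearly closest to `z`: a positive measure set of
directions on a sphere about `x` points towards `z` and yields finite points closer than the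
infimum. -/
theorem IsHarmonicMeasure.dense_posConv_lt_top [SFinite μ] {σ : Measure (S n)}
    (hσ : IsHarmonicMeasure L σ) (hn : 0 < n) (hL : IsEllipticFunctional L lam)
    (hu : IsViscositySupersolution L u) (h : HasDominatedNegPart u μ)
    (hne : ∃ x, posConv u μ x < ⊤) : Dense {x | posConv u μ x < ⊤} := by
  have := hσ.prob
  obtain ⟨t, ht, hcap⟩ := hσ.exists_cap_pos hn hL
  have hne : {x | posConv u μ x < ⊤}.Nonempty := hne
  intro z
  rw [Metric.mem_closure_iff_infDist_zero hne]
  by_contra hd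
  have hd0 : 0 < Metric.infDist z {x | posConv u μ x < ⊤} :=
    lt_of_le_of_ne Metric.infDist_nonneg (Ne.symm hd)
  set d := Metric.infDist z {x | posConv u μ x < ⊤}
  set s := min t (1 / 2)
  have hs0 : 0 < s := lt_min ht (by norm_num)
  have hs1 : s ≤ 1 / 2 := min_le_right _ _
  obtain ⟨x, hx, hxd⟩ := (Metric.infDist_lt_iff (r := d * (1 + s ^ 2 / 2)) hne).1
    (by change d < _; nlinarith [mul_pos hd0 (pow_pos hs0 2)])
  rw [dist_eq_norm, ← norm_neg, neg_sub] at hxd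
  have hdx : d ≤ ‖x - z‖ := by
    rw [← norm_neg, neg_sub, ← dist_eq_norm]
    exact Metric.infDist_le_dist_of_mem hx
  set D := ‖x - z‖
  have hD0 : 0 < D := hd0.trans_le hdx
  set e : E n := D⁻¹ • (z - x) with he
  have hzx : z - x = D • e := by rw [he, smul_smul, mul_inv_cancel₀ hD0.ne', one_smul]
  have he1 : ‖e‖ = 1 := by
    have h1 : ‖z - x‖ = D := norm_sub_rev z x
    rw [he, norm_smul, h1, norm_inv, Real.norm_of_nonneg hD0.le, inv_mul_cancel₀ hD0.ne']
  have hr : 0 < D * s := mul_pos hD0 hs0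
  have hfin : ∀ᵐ y ∂σ, posConv u μ (x + (D * s) • y.1) < ⊤ := by
    refine ae_lt_top ((measurable_posConv hu.lsc).comp (by fun_prop)) ?_
    refine ne_top_of_le_ne_top ?_ (le_self_add.trans (hσ.lintegral_posConv_le hn hL hu x hr))
    exact ENNReal.add_ne_top.2 ⟨(show posConv u μ x < ⊤ from hx).ne, h.lintegral_negConv_ne_top x hr⟩
  refine hcap e he1 (hfin.mono fun y hy => ?_)
  by_contra! hge
  have h1 : d ≤ ‖(x + (D * s) • y.1) - z‖ := by
    rw [← norm_neg, neg_sub, ← dist_eq_norm]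
    exact Metric.infDist_le_dist_of_mem hy
  have h2 : (x + (D * s) • y.1) - z = (D * s) • y.1 - D • e := by
    rw [← hzx]; abel
  have h3 : ‖(D * s) • y.1 - D • e‖ ^ 2 = D ^ 2 * (s ^ 2 - 2 * s * inner ℝ e y.1 + 1) := by
    have hy1 : ‖y.1‖ = 1 := by simp
    rw [norm_sub_sq_real, norm_smul, norm_smul, hy1, he1, real_inner_smul_left,
      real_inner_smul_right, real_inner_comm, Real.norm_of_nonneg hr.le,
      Real.norm_of_nonneg hD0.le]
    ring
  rw [h2] at h1
  have h4 : d ^ 2 ≤ D ^ 2 * (s ^ 2 - 2 * s * inner ℝ e y.1 + 1) := by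
    rw [← h3]; exact pow_le_pow_left₀ hd0.le h1 2
  have h5 : s ≤ inner ℝ e y.1 := (min_le_left _ _).trans hge
  have h6 : D ^ 2 * (s ^ 2 - 2 * s * inner ℝ e y.1 + 1) ≤ D ^ 2 * (1 - s ^ 2) :=
    mul_le_mul_of_nonneg_left (by nlinarith) (sq_nonneg D)
  have h7 : D ^ 2 < (d * (1 + s ^ 2 / 2)) ^ 2 := pow_lt_pow_left₀ hxd hD0.le two_ne_zero
  have hs2 : s ^ 2 ≤ 1 / 4 := by nlinarith
  have h8 : D ^ 2 * (1 - s ^ 2) < (d * (1 + s ^ 2 / 2)) ^ 2 * (1 - s ^ 2) :=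
    mul_lt_mul_of_pos_right h7 (by linarith)
  -- With `a = s²`, `(1 + a/2)²(1 - a) = 1 - 3a²/4 - a³/4`. The factor `1 + s²/2` in the choice of
  -- `x` was made for this.
  have h9 : (d * (1 + s ^ 2 / 2)) ^ 2 * (1 - s ^ 2) ≤ d ^ 2 := by
    have h10 : (1 + s ^ 2 / 2) ^ 2 * (1 - s ^ 2) ≤ 1 := by
      have := sq_nonneg (s ^ 2)
      have h11 : 0 ≤ (s ^ 2) ^ 3 := by positivity
      nlinarith
    nlinarith [mul_le_mul_of_nonneg_left h10 (sq_nonneg d)]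
  linarith

theorem continuous_apply_hessian (L : SymMat n →ₗ[ℝ] ℝ) {φ : E n → ℝ} (hφ : ContDiff ℝ 2 φ) :
    Continuous fun x => L (hessian φ hφ x) := by
  have heq : (fun x => L (hessian φ hφ x)) = fun x => ∑ i, ∑ j,
      L (symUnit i j) * hessianMatrix φ x i j := funext fun x => apply_eq_sum L _
  rw [heq]
  refine continuous_finsetSum _ fun i _ => continuous_finsetSum _ fun j _ =>
    continuous_const.mul ?_
  exact (((contDiff_fderiv hφ).continuous_fderiv (by norm_num)).clm_apply
    continuous_const).clm_apply continuous_const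

/-- If `L` of the Hessian were positive at `x₀`, the average of `φ` over a small sphere would exceed
`φ x₀` by a definite `δ`, whereas `φ ≤ w` and the mean value inequality for `w` bound that average
by `w x₀ = φ x₀`. -/
theorem IsHarmonicMeasure.hessian_nonpos_of_le_convMeasure [SFinite μ] {σ : Measure (S n)}
    (hσ : IsHarmonicMeasure L σ) (hn : 0 < n) (hL : IsEllipticFunctional L lam)
    (hu : IsViscositySupersolution L u) (h : HasDominatedNegPart u μ)
    {φ : E n → ℝ} (hφ : ContDiff ℝ 2 φ) {x₀ : E n} (h₀ : (φ x₀ : EReal) = convMeasure u μ x₀)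
    (hle : ∀ᶠ x in 𝓝 x₀, (φ x : EReal) ≤ convMeasure u μ x) :
    L (hessian φ hφ x₀) ≤ 0 := by
  have := hσ.prob
  by_contra! hpos
  set η := L (hessian φ hφ x₀) / 2 with hη
  have hη0 : 0 < η := by positivity
  have hev : ∀ᶠ x in 𝓝 x₀, η < L (hessian φ hφ x) :=
    (continuous_apply_hessian L hφ).continuousAt.eventually (lt_mem_nhds (by rw [hη]; linarith))
  obtain ⟨ρ, hρ, hball⟩ := Metric.eventually_nhds_iff.1 (hev.and hle)
  set r := ρ / 2 with hr
  have hr0 : 0 < r := by positivity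
  have hmem : ∀ y : E n, ‖y‖ ≤ 1 → dist (x₀ + r • y) x₀ < ρ := fun y hy => by
    rw [dist_eq_norm, add_sub_cancel_left, norm_smul, Real.norm_of_nonneg hr0.le]
    calc r * ‖y‖ ≤ r * 1 := by gcongr
      _ < ρ := by linarith
  have hL1 := (hL.one_pos hn).1
  -- Subtracting `δ‖y‖²` lowers `L` of the rescaled Hessian by exactly `r² η`, and that was above
  -- `r² η`.
  set δ := r ^ 2 * η / (2 * L 1) with hδ
  have hδ0 : 0 < δ := by positivity
  have hφr : ContDiff ℝ 2 fun y => φ (x₀ + r • y) :=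
    hφ.comp (contDiff_const.add (contDiff_id.const_smul r))
  have hQ : ContDiff ℝ 2 (polyFun ((-δ) • normSqPoly n)) := contDiff_polyFun _
  have hg : ContDiff ℝ 2 fun y => φ (x₀ + r • y) + polyFun ((-δ) • normSqPoly n) y := hφr.add hQ
  have hmean := hσ.le_integral hn hL hg (fun y hy => by
    rw [hessian_add hφr hQ, hessian_comp_affine hφ, map_add, map_smul, smul_eq_mul,
      apply_hessian_polyFun, map_smul, polyFun_smul, polyFun_polyOp_normSqPoly]
    have h1 := (hball (hmem y (mem_ball_zero_iff.1 hy).le)).1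
    have h2 : δ * (2 * L 1) = r ^ 2 * η := by rw [hδ]; field_simp
    have h3 := mul_le_mul_of_nonneg_left h1.le (sq_nonneg r)
    linarith)
  have hφc : Continuous fun y : S n => φ (x₀ + r • y.1) :=
    hφr.continuous.comp continuous_subtype_val
  have hQS : ∀ y : S n, polyFun ((-δ) • normSqPoly n) y.1 = -δ := fun y => by
    rw [polyFun_smul, polyFun_normSqPoly, show ‖y.1‖ = 1 by simp]
    ring
  simp only [hQS] at hmean
  rw [integral_add (integrable_sphere hφc) (integrable_const _), polyFun_smul,
    polyFun_normSqPoly] at hmean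
  simp only [smul_zero, add_zero, norm_zero, integral_const, probReal_univ, smul_eq_mul,
    one_mul] at hmean
  -- Shifting by `M` makes `φ` nonnegative on the sphere, so the comparison can be carried out in
  -- `ℝ≥0∞`.
  obtain ⟨M, hM⟩ : ∃ M : ℝ, ∀ y : S n, |φ (x₀ + r • y.1)| ≤ M := by
    obtain ⟨M, hM⟩ := (isCompact_range hφc).isBounded.exists_norm_le
    exact ⟨M, fun y => hM _ (Set.mem_range_self y)⟩
  have hM0 : 0 ≤ M := by
    obtain ⟨y⟩ := nonempty_sphere hn
    exact (abs_nonneg _).trans (hM y)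
  have hnonneg : ∀ y : S n, 0 ≤ φ (x₀ + r • y.1) + M := fun y => by
    have := (abs_le.1 (hM y)).1; linarith
  have hpt : ∀ y : S n, ENNReal.ofReal (φ (x₀ + r • y.1) + M) + negConv u μ (x₀ + r • y.1) ≤
      posConv u μ (x₀ + r • y.1) + ENNReal.ofReal M := by
    intro y
    have h1 := (hball (hmem y.1 (by simp))).2
    have h2 := h.negConv_ne_top (x₀ + r • y.1)
    rw [convMeasure_eq] at h1
    generalize posConv u μ (x₀ + r • y.1) = P at *
    generalize negConv u μ (x₀ + r • y.1) = N at *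
    lift N to NNReal using h2
    induction P with
    | top => simp
    | coe P =>
      have h3 : φ (x₀ + r • y.1) ≤ (P : ℝ) - N := by
        change _ ≤ (((P : ℝ) - (N : ℝ) : ℝ) : EReal) at h1
        exact EReal.coe_le_coe_iff.1 h1
      rw [← ENNReal.ofReal_coe_nnreal (p := N), ← ENNReal.ofReal_coe_nnreal (p := P),
        ← ENNReal.ofReal_add (hnonneg y) N.coe_nonneg, ← ENNReal.ofReal_add P.coe_nonneg hM0]
      exact ENNReal.ofReal_le_ofReal (by linarith)
  have hint : ENNReal.ofReal (∫ y : S n, (φ (x₀ + r • y.1) + M) ∂σ) +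
      ∫⁻ y, negConv u μ (x₀ + r • y.1) ∂σ ≤
      ∫⁻ y, posConv u μ (x₀ + r • y.1) ∂σ + ENNReal.ofReal M := by
    have hofReal : ENNReal.ofReal (∫ y : S n, (φ (x₀ + r • y.1) + M) ∂σ) =
        ∫⁻ y : S n, ENNReal.ofReal (φ (x₀ + r • y.1) + M) ∂σ :=
      ofReal_integral_eq_lintegral_ofReal (integrable_sphere (hφc.add continuous_const))
        (Filter.Eventually.of_forall hnonneg)
    have hmφ : Measurable fun y : S n => ENNReal.ofReal (φ (x₀ + r • y.1) + M) :=
      (hφc.add continuous_const).measurable.ennreal_ofReal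
    rw [hofReal, ← lintegral_add_left hmφ]
    refine (lintegral_mono hpt).trans ?_
    rw [lintegral_add_right _ measurable_const, lintegral_const, measure_univ, mul_one]
  rw [integral_add (integrable_sphere hφc) (integrable_const _)] at hint
  simp only [integral_const, probReal_univ, smul_eq_mul, one_mul] at hint
  have hmv := hσ.lintegral_posConv_le (μ := μ) hn hL hu x₀ hr0
  have hN := h.lintegral_negConv_ne_top (σ := σ) x₀ hr0
  have hkey : ENNReal.ofReal (∫ y : S n, φ (x₀ + r • y.1) ∂σ + M) + negConv u μ x₀ ≤
      posConv u μ x₀ + ENNReal.ofReal M := by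
    refine (ENNReal.add_le_add_iff_right hN).1 ?_
    calc _ = (ENNReal.ofReal (∫ y : S n, φ (x₀ + r • y.1) ∂σ + M) +
          ∫⁻ y, negConv u μ (x₀ + r • y.1) ∂σ) + negConv u μ x₀ := by ring
      _ ≤ (∫⁻ y, posConv u μ (x₀ + r • y.1) ∂σ + ENNReal.ofReal M) + negConv u μ x₀ := by gcongr
      _ = (∫⁻ y, posConv u μ (x₀ + r • y.1) ∂σ + negConv u μ x₀) + ENNReal.ofReal M := by ring
      _ ≤ (posConv u μ x₀ + ∫⁻ y, negConv u μ (x₀ + r • y.1) ∂σ) + ENNReal.ofReal M := by gcongr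
      _ = _ := by ring
  have hI : 0 ≤ ∫ y : S n, φ (x₀ + r • y.1) ∂σ + M := by
    have : 0 ≤ ∫ y : S n, (φ (x₀ + r • y.1) + M) ∂σ := integral_nonneg fun y => hnonneg y
    rw [integral_add (integrable_sphere hφc) (integrable_const _)] at this
    simpa using this
  have h2 := h.negConv_ne_top x₀
  rw [convMeasure_eq] at h₀
  generalize posConv u μ x₀ = P at *
  generalize negConv u μ x₀ = N at *
  lift N to NNReal using h2
  induction P with
  | top => exact EReal.coe_ne_top _ h₀
  | coe P =>
    have h3 : φ x₀ = (P : ℝ) - N := by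
      change _ = (((P : ℝ) - (N : ℝ) : ℝ) : EReal) at h₀
      exact EReal.coe_eq_coe_iff.1 h₀
    rw [← ENNReal.ofReal_coe_nnreal (p := N), ← ENNReal.ofReal_coe_nnreal (p := P),
        ← ENNReal.ofReal_add hI N.coe_nonneg, ← ENNReal.ofReal_add P.coe_nonneg hM0,
        ENNReal.ofReal_le_ofReal_iff (add_nonneg P.coe_nonneg hM0)] at hkey
    simp only [ne_eq, OfNat.ofNat_ne_zero, not_false_eq_true, zero_pow, mul_zero, add_zero] at hmean
    linarith

end Convolution

/-! ### Assembling the theorem and checking the four conditions. -/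

section Main

variable {n : ℕ} {F : SymMat n → ℝ} {u : E n → EReal} {μ : Measure (E n)}

theorem IsViscositySupersolution.of_le {G : SymMat n → ℝ} (hu : IsViscositySupersolution F u)
    (h : ∀ X, G X ≤ F X) : IsViscositySupersolution G u where
  ne_bot := hu.ne_bot
  lsc := hu.lsc
  dense_lt_top := hu.dense_lt_top
  test φ hφ x₀ h₀ hle := (h _).trans (hu.test φ hφ x₀ h₀ hle)

theorem HasDominatedNegPart.convMeasure_lt_top_iff (h : HasDominatedNegPart u μ) (x : E n) :
    convMeasure u μ x < ⊤ ↔ posConv u μ x < ⊤ := by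
  rw [convMeasure_eq]
  have h2 := h.negConv_ne_top x
  generalize posConv u μ x = P at *
  generalize negConv u μ x = N at *
  lift N to NNReal using h2
  induction P with
  | top =>
    simp
  | coe P =>
    have : ((P : ℝ≥0∞) : EReal) - ((N : ℝ≥0∞) : EReal) < ⊤ := EReal.coe_lt_top ((P : ℝ) - (N : ℝ))
    simp [this]

/-- Convolutions with measures preserve supersolutions when the negative parts are dominated. -/
theorem IsViscositySupersolution.convMeasure [SFinite μ] (hn : 0 < n) (hF : IsSublinear F)
    (hell : IsUniformlyElliptic F) (hu : IsViscositySupersolution F u)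
    (h : HasDominatedNegPart u μ) (hne : ∃ x, convMeasure u μ x ≠ ⊤) :
    IsViscositySupersolution F (convMeasure u μ) where
  ne_bot x := coe_sub_ne_bot (h.negConv_ne_top x)
  lsc := lowerSemicontinuous_convMeasure hu.lsc h
  dense_lt_top := by
    obtain ⟨lam, hlam⟩ := hell.isEllipticFunctional hF
    -- Any linear minorant serves here; the base point `0` plays no role.
    obtain ⟨L, hLF, -⟩ := hF.exists_linear_le 0
    obtain ⟨σ, hσ⟩ := exists_isHarmonicMeasure hn (hlam L hLF)
    simp only [h.convMeasure_lt_top_iff]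
    obtain ⟨x, hx⟩ := hne
    exact hσ.dense_posConv_lt_top hn (hlam L hLF) (hu.of_le hLF) h
      ⟨x, (h.convMeasure_lt_top_iff x).1 (lt_top_iff_ne_top.2 hx)⟩
  test φ hφ x₀ h₀ hle := by
    obtain ⟨lam, hlam⟩ := hell.isEllipticFunctional hF
    obtain ⟨L, hLF, hL⟩ := hF.exists_linear_le (hessian φ hφ x₀)
    obtain ⟨σ, hσ⟩ := exists_isHarmonicMeasure hn (hlam L hLF)
    rw [← hL]
    exact hσ.hessian_nonpos_of_le_convMeasure hn (hlam L hLF) (hu.of_le hLF) h hφ h₀ hle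

theorem hasDominatedNegPart_of_nonneg (h : ∀ x, 0 ≤ u x) : HasDominatedNegPart u μ :=
  fun _ _ => ⟨0, aemeasurable_const, by simp, Filter.Eventually.of_forall fun y x _ => by
    rw [EReal.toENNReal_of_nonpos (by simpa using h (x - y))]
    exact zero_le⟩

theorem hasDominatedNegPart_of_integrable
    (h : ∀ R : ℝ, 0 < R → ∃ C : E n → ℝ, Integrable C μ ∧
      ∀ x ∈ Metric.ball (0 : E n) R, ∀ y, max (-u (x - y)) 0 ≤ (C y : EReal)) :
    HasDominatedNegPart u μ := fun R hR => by
  obtain ⟨C, hC, hle⟩ := h R hR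
  refine ⟨fun y => ENNReal.ofReal (C y), hC.aestronglyMeasurable.aemeasurable.ennreal_ofReal,
    hC.lintegral_lt_top.ne, Filter.Eventually.of_forall fun y x hx => ?_⟩
  change _ ≤ ENNReal.ofReal (C y)
  rw [← EReal.real_coe_toENNReal]
  exact EReal.toENNReal_le_toENNReal ((le_max_left _ _).trans (hle x hx y))

/-- For `x` in a ball and `y` in the support, `x - y` stays in a compact set, where `u` is bounded
below. -/
theorem hasDominatedNegPart_of_isCompact_support [IsFiniteMeasureOnCompacts μ]
    (hbot : ∀ x, u x ≠ ⊥) (hlsc : LowerSemicontinuous u) (hμ : IsCompact μ.support) :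
    HasDominatedNegPart u μ := fun R hR => by
  obtain ⟨K, -, hK⟩ := exists_neg_le_of_lowerSemicontinuous hbot hlsc
    (((isCompact_closedBall (0 : E n) R).prod hμ).image continuous_sub)
  refine ⟨μ.support.indicator fun _ => ENNReal.ofReal K,
    aemeasurable_const.indicator hμ.measurableSet, ?_, ?_⟩
  · rw [lintegral_indicator hμ.measurableSet, lintegral_const, Measure.restrict_apply_univ]
    exact ENNReal.mul_ne_top ENNReal.ofReal_ne_top hμ.measure_lt_top.ne
  · filter_upwards [Measure.support_mem_ae] with y hy x hx
    rw [Set.indicator_of_mem hy, ← EReal.real_coe_toENNReal]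
    refine EReal.toENNReal_le_toENNReal ?_
    have := hK (x - y) ⟨(x, y), ⟨Metric.ball_subset_closedBall hx, hy⟩, rfl⟩
    rw [EReal.coe_neg] at this
    exact EReal.neg_le_of_neg_le this

theorem lintegral_ball_enorm_rpow_lt_top (hn : 0 < n) {α : ℝ} (hα : α < n) (R : ℝ) :
    ∫⁻ x in Metric.ball (0 : E n) R, ‖x‖ₑ ^ (-α) < ⊤ := by
  have : Nontrivial (E n) := by
    have : Nonempty (Fin n) := ⟨⟨0, hn⟩⟩
    infer_instance
  have hint : IntegrableOn (fun x : E n => ‖x‖ ^ (-α)) (Metric.ball 0 R) := by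
    refine integrableOn_ball_of_norm_le_rpow (C := 1) (α := α) (by simpa using Nat.succ_le_of_lt hn)
      (by simpa using hα) (Filter.Eventually.of_forall fun x => ?_)
      (by fun_prop : Measurable fun x : E n => ‖x‖ ^ (-α)).aestronglyMeasurable
    rw [one_mul, Real.norm_of_nonneg (by positivity)]
  refine lt_of_eq_of_lt (lintegral_congr_ae ?_) hint.lintegral_lt_top
  refine ae_restrict_of_ae ?_
  -- The origin is excluded because the conventions differ there: for `α > 0` the power `0 ^ (-α)`
  -- is `0` in `ℝ` and `⊤` in `ℝ≥0∞`.
  filter_upwards [Measure.ae_ne volume (0 : E n)] with x hx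
  rw [← ofReal_norm, ENNReal.ofReal_rpow_of_pos (norm_pos_iff.2 hx)]

/-- Riesz potentials of measures with a moment condition are finite somewhere. -/
theorem exists_lintegral_enorm_sub_rpow_lt_top [IsLocallyFiniteMeasure μ] (hn : 0 < n) {α : ℝ}
    (hα0 : 0 ≤ α) (hα : α < n)
    (hμ : ∫⁻ y in {y : E n | 1 ≤ ‖y‖}, ‖y‖ₑ ^ (-α) ∂μ < ⊤) :
    ∃ x : E n, ∫⁻ y, ‖x - y‖ₑ ^ (-α) ∂μ < ⊤ := by
  have hk : Measurable fun q : E n × E n => ‖q.1 - q.2‖ₑ ^ (-α) := by fun_prop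
  set B := Metric.closedBall (0 : E n) 2
  have hBm : MeasurableSet B := Metric.isClosed_closedBall.measurableSet
  -- For `‖x‖ < 1` and `‖y‖ > 2` one has `‖y‖ ≤ 2‖x - y‖`, so the moment condition controls the far
  -- part at every such `x`.
  have hfar : ∀ x ∈ Metric.ball (0 : E n) 1, ∫⁻ y in Bᶜ, ‖x - y‖ₑ ^ (-α) ∂μ < ⊤ := by
    intro x hx
    rw [mem_ball_zero_iff] at hx
    have hbound : ∀ y ∈ Bᶜ, ‖x - y‖ₑ ^ (-α) ≤ 2 ^ α * ‖y‖ₑ ^ (-α) := by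
      intro y hy
      have hy2 : 2 < ‖y‖ := by simpa [B] using hy
      have h1 : ‖y‖ ≤ 2 * ‖x - y‖ := by
        have := norm_sub_norm_le y x
        rw [norm_sub_rev] at this
        linarith
      have h2 : ‖y‖ₑ ≤ 2 * ‖x - y‖ₑ := by
        have h22 : (2 : ℝ≥0∞) = ENNReal.ofReal 2 := by simp
        calc ‖y‖ₑ = ENNReal.ofReal ‖y‖ := (ofReal_norm y).symm
          _ ≤ ENNReal.ofReal (2 * ‖x - y‖) := ENNReal.ofReal_le_ofReal h1
          _ = 2 * ‖x - y‖ₑ := by rw [ENNReal.ofReal_mul zero_le_two, ← h22, ofReal_norm]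
      have h3 : ‖y‖ₑ ^ α ≤ 2 ^ α * ‖x - y‖ₑ ^ α := by
        rw [← ENNReal.mul_rpow_of_nonneg _ _ hα0]
        exact ENNReal.rpow_le_rpow h2 hα0
      have h20 : (2 : ℝ≥0∞) ^ α ≠ 0 := by simp
      have h2t : (2 : ℝ≥0∞) ^ α ≠ ⊤ := ENNReal.rpow_ne_top_of_nonneg hα0 (by simp)
      rw [ENNReal.rpow_neg, ENNReal.rpow_neg]
      calc (‖x - y‖ₑ ^ α)⁻¹ = 2 ^ α * (2 ^ α * ‖x - y‖ₑ ^ α)⁻¹ := by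
            rw [ENNReal.mul_inv (Or.inl h20) (Or.inl h2t), ← mul_assoc,
              ENNReal.mul_inv_cancel h20 h2t, one_mul]
        _ ≤ 2 ^ α * (‖y‖ₑ ^ α)⁻¹ := by gcongr
    refine (setLIntegral_mono' hBm.compl hbound).trans_lt ?_
    rw [lintegral_const_mul _ (by fun_prop)]
    refine ENNReal.mul_lt_top (ENNReal.rpow_lt_top_of_nonneg hα0 (by simp)) ?_
    refine (lintegral_mono_set fun y hy => ?_).trans_lt hμ
    have hy2 : 2 < ‖y‖ := by simpa [B] using hy
    exact (by linarith : 1 ≤ ‖y‖)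
  -- The near part is integrated in `x` over the unit ball: by Tonelli and translation the kernel
  -- contributes at most its integral over the ball of radius `3 = 1 + 2`, and `B` has finite
  -- `μ`-measure. Hence the near part is finite for almost every `x` in the unit ball.
  have hnear : ∫⁻ x in Metric.ball (0 : E n) 1, ∫⁻ y in B, ‖x - y‖ₑ ^ (-α) ∂μ ≠ ⊤ := by
    rw [lintegral_lintegral_swap hk.aemeasurable]
    have hbound : ∀ y ∈ B, ∫⁻ x in Metric.ball (0 : E n) 1, ‖x - y‖ₑ ^ (-α) ≤
        ∫⁻ x in Metric.ball (0 : E n) 3, ‖x‖ₑ ^ (-α) := by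
      intro y hy
      have hy2 : ‖y‖ ≤ 2 := by simpa [B] using hy
      rw [← lintegral_indicator Metric.isOpen_ball.measurableSet,
        ← lintegral_indicator Metric.isOpen_ball.measurableSet,
        ← lintegral_sub_right_eq_self
          ((Metric.ball (0 : E n) 3).indicator fun x => ‖x‖ₑ ^ (-α)) y]
      refine lintegral_mono fun x => ?_
      refine Set.indicator_apply_le' (fun hx => ?_) fun _ => zero_le
      have hx1 : ‖x‖ < 1 := by simpa using hx
      have : x - y ∈ Metric.ball (0 : E n) 3 := by
        rw [mem_ball_zero_iff]
        linarith [norm_sub_le x y]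
      rw [Set.indicator_of_mem this]
    refine ((setLIntegral_mono' hBm hbound).trans_lt ?_).ne
    rw [lintegral_const, Measure.restrict_apply_univ]
    exact ENNReal.mul_lt_top (lintegral_ball_enorm_rpow_lt_top hn hα 3)
      (isCompact_closedBall _ _).measure_lt_top
  have hae := ae_lt_top (hk.lintegral_prod_right' (ν := μ.restrict B)) hnear
  obtain ⟨x, hx, hxB⟩ : ∃ x, ∫⁻ y in B, ‖x - y‖ₑ ^ (-α) ∂μ < ⊤ ∧ x ∈ Metric.ball (0 : E n) 1 := by
    have hne : (ae (volume.restrict (Metric.ball (0 : E n) 1))).NeBot := by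
      rw [ae_neBot, ne_eq, Measure.restrict_eq_zero]
      exact (Metric.measure_ball_pos volume _ one_pos).ne'
    exact (hae.and (ae_restrict_mem Metric.isOpen_ball.measurableSet)).exists
  refine ⟨x, ?_⟩
  rw [← lintegral_add_compl _ hBm]
  exact ENNReal.add_lt_top.2 ⟨hx, hfar x hxB⟩

end Main

end SublinearElliptic

/-- `(max (-u (x - y)) 0)` is the negative part `u⁻(x - y)`; `μ.Regular` says that `μ` is Radon. -/
theorem mainTheorem9 (n : ℕ) (hn : 2 ≤ n)
    (F : SublinearElliptic.SymMat n → ℝ)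
    (hF : SublinearElliptic.IsSublinear F)
    (hell : SublinearElliptic.IsUniformlyElliptic F)
    (u : EuclideanSpace ℝ (Fin n) → EReal)
    (hu : SublinearElliptic.IsViscositySupersolution F u)
    (μ : Measure (EuclideanSpace ℝ (Fin n))) (hμ : μ.Regular)
    (h :
      -- 1. a locally uniform integrable bound on the negative part
      ((∃ x, SublinearElliptic.convMeasure u μ x ≠ ⊤) ∧
        ∀ R : ℝ, 0 < R → ∃ C : EuclideanSpace ℝ (Fin n) → ℝ, Integrable C μ ∧
          ∀ x ∈ Metric.ball (0 : EuclideanSpace ℝ (Fin n)) R, ∀ y,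
            max (-u (x - y)) 0 ≤ (C y : EReal)) ∨
      -- 2. nonnegativity
      ((∃ x, SublinearElliptic.convMeasure u μ x ≠ ⊤) ∧ ∀ x, 0 ≤ u x) ∨
      -- 3. `u(x) = c |x| ^ ((p - n) / (p - 1))`, with a moment condition on `μ`
      (∃ c p : ℝ, 0 ≤ c ∧ 2 ≤ p ∧ p < n ∧
        (∀ x, u x = ((ENNReal.ofReal c * ‖x‖ₑ ^ ((p - n) / (p - 1)) : ℝ≥0∞) : EReal)) ∧
        ∫⁻ y in {y | 1 ≤ ‖y‖}, ‖y‖ₑ ^ ((p - n) / (p - 1)) ∂μ < ⊤) ∨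
      -- 4. compactly supported measure
      ((∃ x, SublinearElliptic.convMeasure u μ x ≠ ⊤) ∧ IsCompact μ.support)) :
    SublinearElliptic.IsViscositySupersolution F (SublinearElliptic.convMeasure u μ) := by
  have hn0 : 0 < n := by omega
  rcases h with ⟨hne, hC⟩ | ⟨hne, hu0⟩ | ⟨c, p, hc, hp, hpn, hup, hmom⟩ | ⟨hne, hcpt⟩
  · exact hu.convMeasure hn0 hF hell
      (SublinearElliptic.hasDominatedNegPart_of_integrable hC) hne
  · exact hu.convMeasure hn0 hF hell
      (SublinearElliptic.hasDominatedNegPart_of_nonneg hu0) hne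
  · have hdom : SublinearElliptic.HasDominatedNegPart u μ :=
      SublinearElliptic.hasDominatedNegPart_of_nonneg fun x => by
        rw [hup]; exact EReal.coe_ennreal_nonneg _
    have hexp : (p - n) / (p - 1) = -((n - p) / (p - 1)) := by ring
    rw [hexp] at hmom hup
    have hα0 : 0 ≤ (n - p) / (p - 1) := div_nonneg (by linarith) (by linarith)
    -- Since `p - 1 ≥ 1`, the exponent is at most `n - p`, so the kernel is locally integrable.
    have hα : (n - p) / (p - 1) < n := by
      rw [div_lt_iff₀ (by linarith)]
      nlinarith
    obtain ⟨x, hx⟩ :=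
      SublinearElliptic.exists_lintegral_enorm_sub_rpow_lt_top hn0 hα0 hα hmom
    refine hu.convMeasure hn0 hF hell hdom ⟨x, ?_⟩
    rw [← lt_top_iff_ne_top, hdom.convMeasure_lt_top_iff, SublinearElliptic.posConv]
    simp only [hup, EReal.toENNReal_coe]
    rw [lintegral_const_mul _ (by fun_prop)]
    exact ENNReal.mul_lt_top ENNReal.ofReal_lt_top hx
  · exact hu.convMeasure hn0 hF hell
      (SublinearElliptic.hasDominatedNegPart_of_isCompact_support hu.ne_bot hu.lsc hcpt) hne
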